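/- Corollary 4.25. Fix $n\ge 4$ with $n\ne 6$, and let $\mathfrak S_n$ be the symmetric group on $n$ letters, regarded as a structure in the language of pure groups $\{\cdot\}$. The class of *h-formulas* is the smallest class of formulas containing the atomic formulas and closed under $\varphi\wedge\psi$, $(\exists x)\varphi$, $(\forall x)\varphi$ and $(\exists x)\varphi\wedge(\forall x)(\varphi\to\psi)$. For every $k\ge 1$, every complete $k$-type $p(x_1,\dots,x_k)$ (without parameters) of the theory of $\mathfrak S_n$ is isolated by an h-formula in the language of groups. For each such $p$ let $\phi_p(x_1,\dots,x_k)$ be any h-formula isolating $p$. Let $\mathbb I$ be a set and let $\mathcal I$ be an ideal on $\mathbb I$, that is, a nonempty family of subsets of $\mathbb I$ that is closed under subsets and finite unions and does not contain $\mathbb I$. Let $\mathcal P(\mathbb I)/\mathcal I$ be the quotient Boolean algebra, and let $G=\prod_{\mathbb I}\mathfrak S_n/\mathcal I$ be the reduced power, that is, the group of all functions $\mathbb I\to\mathfrak S_n$ modulo the relation $\{i: a_i\neq b_i\}\in\mathcal I$. For $\bar a\in G^k$ put $$\operatorname{supp}_{\phi_p}(\bar a)=[\{i\in\mathbb I:\mathfrak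 S_n\models\phi_p(\bar a_i)\}]_{\mathcal I}\in\mathcal P(\mathbb I)/\mathcal I .$$ Consider the two-sorted structure $$G^+=\bigl((G,\cdot),\ (\mathcal P(\mathbb I)/\mathcal I,\subseteq),\ (\operatorname{supp}_{\phi_p})_{p}\bigr),$$ where $p$ ranges over all complete $k$-types of $\mathfrak S_n$, $k\ge 1$. Then: 1. $G^+$ is an interpretable expansion of the group $(G,\cdot)$, without parameters: there are $m\in\mathbb N$, a $\emptyset$-definable set $D\subseteq G^m$ and a surjection $\beta\colon D\to\mathcal P(\mathbb I)/\mathcal I$ such that the relations $\beta(x)=\beta(y)$ and $\beta(x)\subseteq\beta(y)$ on $D$ and, for every $p$, the relation $\operatorname{supp}_{\phi_p}(\bar a)=\beta(y)$ on $G^k\times D$ are $\emptyset$-definable in $(G,\cdot)$. 2. $G^+$ eliminates quantifiers relative to $(\mathcal P(\mathbb I)/\mathcal I,\subseteq)$: every first-order formula in the language of $G^+$ (with free variables of either sort) is equivalent in $G^+$ to a propositional combination of equations between group terms and of formulas $\psi(\tau_1,\dots,\tau_r)$, where $\psi$ is a first-order formula of $(\mathcal P(\mathbb I)/\mathcal I,\subseteq)$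 and the $\tau_j$ are terms of the Boolean sort. In particular no variable of the group sort is quantified in it. -/

import Mathlib

namespace SymReducedPower

universe u v w

/-! ### The language of groups -/

/-- Function symbols of the language of (pure) groups: only the multiplication. -/
inductive GroupFunc : ℕ → Type
  | mul : GroupFunc 2

/-- The language of pure groups `(G, ·)`. -/
def groupLang : FirstOrder.Language.{0, 0} := ⟨GroupFunc, fun _ => Empty⟩

/-- Every set with a multiplication is a structure for the language of pure groups. -/
instance mulStructure (M : Type u) [Mul M] : groupLang.Structure M where
  funMap {_} f x :=
    match f, x with
    | GroupFunc.mul, x => x 0 * x 1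
  RelMap {_} r _ := nomatch r

/-! ### h-formulas -/

/-- The class of h-formulas: the smallest class of formulas containing the atomic formulas and
closed under `φ ∧ ψ`, `∃ x, φ`, `∀ x, φ` and `(∃ x, φ) ∧ ∀ x, (φ → ψ)`. -/
inductive IsHFormula {L : FirstOrder.Language.{u, v}} {α : Type w} :
    ∀ {m : ℕ}, L.BoundedFormula α m → Prop
  | atomic {m : ℕ} {φ : L.BoundedFormula α m} : φ.IsAtomic → IsHFormula φ
  | and {m : ℕ} {φ ψ : L.BoundedFormula α m} :
      IsHFormula φ → IsHFormula ψ → IsHFormula (φ ⊓ ψ)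
  | ex {m : ℕ} {φ : L.BoundedFormula α (m + 1)} : IsHFormula φ → IsHFormula φ.ex
  | all {m : ℕ} {φ : L.BoundedFormula α (m + 1)} : IsHFormula φ → IsHFormula φ.all
  | exAndAllImp {m : ℕ} {φ ψ : L.BoundedFormula α (m + 1)} :
      IsHFormula φ → IsHFormula ψ → IsHFormula (φ.ex ⊓ (φ.imp ψ).all)

/-! ### Types of the symmetric group and formulas isolating them -/

/-- The formula `φ` isolates the complete type `p` over `T`: `p` is the only complete type over `T`
that contains `φ`. -/
def Isolates {L : FirstOrder.Language.{u, v}} {T : L.Theory} {α : Type w}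
    (φ : L.Formula α) (p : T.CompleteType α) : Prop :=
  ∀ q : T.CompleteType α, FirstOrder.Language.Formula.equivSentence φ ∈ q ↔ q = p

/-- The complete parameter-free `k`-types of the symmetric group on `n` letters, as a pure group. -/
abbrev SymType (n k : ℕ) : Type :=
  (groupLang.completeTheory (Equiv.Perm (Fin n))).CompleteType (Fin k)

/-- Index set of the support functions: pairs of an arity `k = j + 1 ≥ 1` and a complete `k`-type
of the symmetric group on `n` letters. -/
abbrev SuppSymbol (n : ℕ) : Type := Σ j : ℕ, SymType n (j + 1)

/-- The arity of a support function. -/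
abbrev SuppSymbol.arity {n : ℕ} (s : SuppSymbol n) : ℕ := s.1 + 1

/-- `Φ` chooses for every complete `k`-type `p` (`k ≥ 1`) of the symmetric group an h-formula
`φ_p` that isolates `p`. -/
def IsIsolatingFamily {n : ℕ} (Φ : ∀ s : SuppSymbol n, groupLang.Formula (Fin s.arity)) : Prop :=
  ∀ s : SuppSymbol n, IsHFormula (Φ s) ∧ Isolates (Φ s) s.2

/-! ### Reduced powers and the quotient Boolean algebra -/

section Reduced

variable {ι : Type u} (𝓘 : Order.Ideal (Set ι))

/-- Equality of sequences modulo the ideal `𝓘`. -/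
def powerSetoid (M : Type v) : Setoid (ι → M) where
  r f g := {i | f i ≠ g i} ∈ 𝓘
  iseqv :=
    { refl := fun f => by simpa using 𝓘.bot_mem
      symm := fun {f g} h => by simpa only [ne_comm] using h
      trans := fun {f g k} h₁ h₂ => by
        refine 𝓘.lower ?_ (Order.Ideal.sup_mem h₁ h₂)
        intro i hi
        by_contra hc
        simp only [Set.sup_eq_union, Set.mem_union, Set.mem_ofPred_eq, not_or, not_not] at hc
        exact hi (hc.1.trans hc.2) }

/-- The reduced power of `M` modulo the ideal `𝓘`. -/
def ReducedPower (M : Type v) : Type (max u v) := Quotient (powerSetoid 𝓘 M)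

/-- The class of a sequence in the reduced power. -/
def ReducedPower.mk {M : Type v} (f : ι → M) : ReducedPower 𝓘 M := Quotient.mk (powerSetoid 𝓘 M) f

/-- Coordinatewise multiplication on the reduced power. -/
instance reducedPowerMul (M : Type v) [Mul M] : Mul (ReducedPower 𝓘 M) where
  mul := Quotient.map₂ (fun f g i => f i * g i) (by
    intro f f' hf g g' hg
    refine 𝓘.lower ?_ (Order.Ideal.sup_mem hf hg)
    intro i hi
    by_contra hc
    simp only [Set.sup_eq_union, Set.mem_union, Set.mem_ofPred_eq, not_or, not_not] at hc
    exact hi (by simp only [hc.1, hc.2]))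

/-- Equality of subsets of `ι` modulo the ideal `𝓘`. -/
def setSetoid : Setoid (Set ι) where
  r A B := symmDiff A B ∈ 𝓘
  iseqv :=
    { refl := fun A => by simpa using 𝓘.bot_mem
      symm := fun {A B} h => by simpa only [symmDiff_comm] using h
      trans := fun {A B C} h₁ h₂ =>
        𝓘.lower (symmDiff_triangle A B C) (Order.Ideal.sup_mem h₁ h₂) }

/-- The quotient Boolean algebra `𝒫(ι)/𝓘`. -/
def QuotAlg : Type u := Quotient (setSetoid 𝓘)

/-- The class of a set in `𝒫(ι)/𝓘`. -/
def QuotAlg.mk (A : Set ι) : QuotAlg 𝓘 := Quotient.mk (setSetoid 𝓘) A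

/-- The inclusion relation of `𝒫(ι)/𝓘`: `[A] ⊆ [B]` means that `A \ B` belongs to `𝓘`. -/
instance quotAlgLE : LE (QuotAlg 𝓘) where
  le := Quotient.lift₂ (fun A B => A \ B ∈ 𝓘) (by
    have key : ∀ A B A' B' : Set ι, symmDiff A A' ∈ 𝓘 → symmDiff B B' ∈ 𝓘 →
        A \ B ∈ 𝓘 → A' \ B' ∈ 𝓘 := by
      intro A B A' B' hA hB h
      refine 𝓘.lower ?_ (Order.Ideal.sup_mem h (Order.Ideal.sup_mem hA hB))
      intro i hi
      simp only [Set.sup_eq_union, Set.mem_union, Set.mem_sdiff, Set.mem_symmDiff] at hi ⊢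
      tauto
    intro A B A' B' hA hB
    refine propext ⟨key A B A' B' hA hB, key A' B' A B ?_ ?_⟩
    · rw [symmDiff_comm]; exact hA
    · rw [symmDiff_comm]; exact hB)

/-- The `φ`-support of a tuple of elements of the reduced power: the class of the set of
coordinates at which `φ` holds. It is computed on representatives; the choice does not matter
(`supp_mk`). -/
noncomputable def supp {L : FirstOrder.Language} {M : Type v} [L.Structure M] {k : ℕ} (φ : L.Formula (Fin k))
    (a : Fin k → ReducedPower 𝓘 M) : QuotAlg 𝓘 :=
  QuotAlg.mk 𝓘 {i | φ.Realize fun j => Quotient.out (a j) i}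

theorem supp_mk {L : FirstOrder.Language} {M : Type v} [L.Structure M] {k : ℕ} (φ : L.Formula (Fin k))
    (f : Fin k → ι → M) :
    supp 𝓘 φ (fun j => ReducedPower.mk 𝓘 (f j)) = QuotAlg.mk 𝓘 {i | φ.Realize fun j => f j i} := by
  refine Quotient.sound (s := setSetoid 𝓘) ?_
  have h : ∀ s : Finset (Fin k),
      {i | ∃ j ∈ s, Quotient.out (ReducedPower.mk 𝓘 (f j)) i ≠ f j i} ∈ 𝓘 := by
    intro s
    induction s using Finset.induction_on with
    | empty => simpa using 𝓘.bot_mem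
    | insert a s _ ih =>
      have ha : {i | Quotient.out (ReducedPower.mk 𝓘 (f a)) i ≠ f a i} ∈ 𝓘 :=
        Quotient.mk_out (s := powerSetoid 𝓘 M) (f a)
      refine 𝓘.lower ?_ (Order.Ideal.sup_mem ha ih)
      rintro i ⟨j, hj, hne⟩
      rcases Finset.mem_insert.1 hj with rfl | hj
      · exact Or.inl hne
      · exact Or.inr ⟨j, hj, hne⟩
  refine 𝓘.lower ?_ (h Finset.univ)
  intro i hi
  by_contra hc
  simp only [Finset.mem_univ, true_and, Set.mem_ofPred_eq, not_exists, ne_eq, not_not] at hc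
  simp only [Set.mem_symmDiff, Set.mem_ofPred_eq, hc] at hi
  tauto

end Reduced

/-! ### Interpretable two-sorted expansions -/

/-- The two-sorted expansion of the `L`-structure `M` by a second sort `(B, ≤)` and functions
`f j : M ^ (arity j) → B` is interpretable in `M` without parameters: `B` is the image of a
definable set `D ⊆ M ^ m` under a map `β` such that, pulled back along `β`, equality and the order
of `B` and the graphs of all `f j` are definable without parameters. (The sort `M` itself is
interpreted identically.) -/
def IsInterpretableExpansion (L : FirstOrder.Language.{0, 0}) (M : Type u) [L.Structure M]
    (B : Type v) [LE B] {J : Type w} (arity : J → ℕ) (f : ∀ j, (Fin (arity j) → M) → B) : Prop :=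
  ∃ (m : ℕ) (D : Set (Fin m → M)) (β : (Fin m → M) → B),
    (∅ : Set M).Definable L D ∧
    (∀ b : B, ∃ x ∈ D, β x = b) ∧
    (∅ : Set M).Definable L {z : Fin m ⊕ Fin m → M |
      z ∘ Sum.inl ∈ D ∧ z ∘ Sum.inr ∈ D ∧ β (z ∘ Sum.inl) = β (z ∘ Sum.inr)} ∧
    (∅ : Set M).Definable L {z : Fin m ⊕ Fin m → M |
      z ∘ Sum.inl ∈ D ∧ z ∘ Sum.inr ∈ D ∧ β (z ∘ Sum.inl) ≤ β (z ∘ Sum.inr)} ∧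
    ∀ j : J, (∅ : Set M).Definable L {z : Fin (arity j) ⊕ Fin m → M |
      z ∘ Sum.inr ∈ D ∧ f j (z ∘ Sum.inl) = β (z ∘ Sum.inr)}

/-! ### Two-sorted first-order formulas -/

section TwoSorted

variable {J : Type w} (arity : J → ℕ)

/-- Terms of the Boolean sort, with `a` variables of the group sort and `b` variables of the
Boolean sort: variables, and the function symbols `j : J` applied to group terms. -/
inductive BTerm (a b : ℕ) : Type w
  | var : Fin b → BTerm a b
  | app (j : J) : (Fin (arity j) → groupLang.Term (Fin a)) → BTerm a b

/-- Formulas of the two-sorted language with a group sort (symbol `·`), a Boolean sort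
(symbol `⊆`) and function symbols `j : J` from tuples of the group sort to the Boolean sort.
The free variables are `a` variables of the group sort and `b` variables of the Boolean sort;
a quantifier binds the last variable of its sort. -/
inductive TSFormula : ℕ → ℕ → Type w
  | falsum {a b : ℕ} : TSFormula a b
  | eqG {a b : ℕ} : groupLang.Term (Fin a) → groupLang.Term (Fin a) → TSFormula a b
  | eqB {a b : ℕ} : BTerm arity a b → BTerm arity a b → TSFormula a b
  | subB {a b : ℕ} : BTerm arity a b → BTerm arity a b → TSFormula a b
  | imp {a b : ℕ} : TSFormula a b → TSFormula a b → TSFormula a b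
  | allG {a b : ℕ} : TSFormula (a + 1) b → TSFormula a b
  | allB {a b : ℕ} : TSFormula a (b + 1) → TSFormula a b

variable {arity}

/-- Value of a term of the Boolean sort. -/
def BTerm.realize {G : Type u} [Mul G] {B : Type v} (f : ∀ j, (Fin (arity j) → G) → B)
    {a b : ℕ} (x : Fin a → G) (y : Fin b → B) : BTerm arity a b → B
  | .var i => y i
  | .app j t => f j fun i => (t i).realize x

/-- Satisfaction of a two-sorted formula. -/
def TSFormula.Realize {G : Type u} [Mul G] {B : Type v} [LE B]
    (f : ∀ j, (Fin (arity j) → G) → B) :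
    ∀ {a b : ℕ}, TSFormula arity a b → (Fin a → G) → (Fin b → B) → Prop
  | _, _, .falsum, _, _ => False
  | _, _, .eqG s t, x, _ => s.realize x = t.realize x
  | _, _, .eqB s t, x, y => s.realize f x y = t.realize f x y
  | _, _, .subB s t, x, y => s.realize f x y ≤ t.realize f x y
  | _, _, .imp φ ψ, x, y => φ.Realize f x y → ψ.Realize f x y
  | _, _, .allG φ, x, y => ∀ g : G, φ.Realize f (Fin.snoc x g : Fin _ → G) y
  | _, _, .allB φ, x, y => ∀ c : B, φ.Realize f x (Fin.snoc y c : Fin _ → B)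

/-- A formula obtained from a first-order formula of the Boolean sort `(B, ⊆)` by substituting
terms of the Boolean sort for its free variables. -/
inductive IsBoolean : ∀ {a b : ℕ}, TSFormula arity a b → Prop
  | falsum {a b : ℕ} : IsBoolean (.falsum : TSFormula arity a b)
  | eqB {a b : ℕ} (s t : BTerm arity a b) : IsBoolean (.eqB s t)
  | subB {a b : ℕ} (s t : BTerm arity a b) : IsBoolean (.subB s t)
  | imp {a b : ℕ} {φ ψ : TSFormula arity a b} : IsBoolean φ → IsBoolean ψ → IsBoolean (.imp φ ψ)
  | allB {a b : ℕ} {φ : TSFormula arity a (b + 1)} : IsBoolean φ → IsBoolean (.allB φ)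

/-- A formula that is quantifier-free relative to the Boolean sort: a propositional combination of
equations between group terms and of formulas of the Boolean sort evaluated at terms, that is, a
quantifier-free formula of the Morleyization of the Boolean sort. In particular no variable of the
group sort is quantified. -/
inductive IsRelQF : ∀ {a b : ℕ}, TSFormula arity a b → Prop
  | eqG {a b : ℕ} (s t : groupLang.Term (Fin a)) : IsRelQF (.eqG s t : TSFormula arity a b)
  | boolean {a b : ℕ} {φ : TSFormula arity a b} : IsBoolean φ → IsRelQF φ
  | imp {a b : ℕ} {φ ψ : TSFormula arity a b} : IsRelQF φ → IsRelQF ψ → IsRelQF (.imp φ ψ)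

/-- The two-sorted structure `((G, ·), (B, ⊆), f)` eliminates quantifiers relative to `(B, ⊆)`:
in it every formula is equivalent to one that is quantifier-free relative to the Boolean sort. -/
def EliminatesQuantifiersRelative {G : Type u} [Mul G] {B : Type v} [LE B]
    (f : ∀ j, (Fin (arity j) → G) → B) : Prop :=
  ∀ (a b : ℕ) (φ : TSFormula arity a b), ∃ ψ : TSFormula arity a b, IsRelQF ψ ∧
    ∀ (x : Fin a → G) (y : Fin b → B), φ.Realize f x y ↔ ψ.Realize f x y

end TwoSorted

end SymReducedPower

/-! The engine is that an h-formula holds in a reduced power exactly when it holds at almost all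
coordinates (`IsHFormula.realize_mk_iff`). So the task is to express enough of the finite group by
h-formulas, which have no negation, and in particular to express nontriviality.

Nontriviality comes from an element `v` as in `IsMonolithic`: in degree 4 a double transposition, in
degree at least 5 any nontrivial even permutation. The property "all commutators of elements of the
centralizer of `x` lie in the subgroup generated by the commutators with `x`" is given by an
h-formula, holds at `v`, and fails at 1 because the group is not abelian. Writing down the
multiplication table of the group and imposing this property on the image of `v` forces the
resulting endomorphism to be injective, since a nontrivial kernel would contain `v`. Hence the
orbits of tuples under automorphisms are given by h-formulas (`IsMonolithic.exists_hFormula_orbit`).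
Since the group is finite, every type is realized, types are exactly these orbits, and each type is
isolated by an h-formula.

For the interpretation, an element of the reduced power codes the class of the set of coordinates
where it is nontrivial. Inclusion of such classes is definable through normal subgroups generated by
commutators (`IsMonolithic.definable_le`), and comparison with the supports of h-formulas through
`IsMonolithic.le_supp_iff`.

For the elimination, the truth of a formula at a tuple depends only, and definably in the quotient
algebra, on the finite family of supports of the types of the tuple
(`IsMonolithic.exists_definablePred`). A group quantifier turns into a quantifier over refinements
of this partition: types being orbits, an extension of a type is realized over every realization of
it, so every refinement compatible with restriction of types comes from an element, built coordinate
by coordinate (`isRefinement_iff`). Equations between group terms are absorbed too: they say that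
the types violating them have support zero. -/

namespace SymReducedPower

open FirstOrder FirstOrder.Language

/-! ### Predicates definable by h-formulas -/

section HDefinable

universe u v

variable {M : Type u} [Mul M] {α : Type v} {m : ℕ}

/-- A function of the variables that is given by a term. -/
def IsTermFun (τ : (α → M) → (Fin m → M) → M) : Prop :=
  ∃ t : groupLang.Term (α ⊕ Fin m), ∀ v xs, t.realize (Sum.elim v xs) = τ v xs

/-- A predicate of the variables that is given by an h-formula. -/
def HDefinable (P : (α → M) → (Fin m → M) → Prop) : Prop :=
  ∃ φ : groupLang.BoundedFormula α m, IsHFormula φ ∧ ∀ v xs, φ.Realize v xs ↔ P v xs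

theorem IsTermFun.free (a : α) : IsTermFun (fun (v : α → M) (_ : Fin m → M) => v a) :=
  ⟨Term.var (Sum.inl a), fun _ _ => rfl⟩

theorem IsTermFun.bound (j : Fin m) : IsTermFun (fun (_ : α → M) (xs : Fin m → M) => xs j) :=
  ⟨Term.var (Sum.inr j), fun _ _ => rfl⟩

/-- The symbol of the multiplication. -/
def mulSymbol : groupLang.Functions 2 := GroupFunc.mul

theorem IsTermFun.mul {σ τ : (α → M) → (Fin m → M) → M} (hσ : IsTermFun σ) (hτ : IsTermFun τ) :
    IsTermFun fun v xs => σ v xs * τ v xs := by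
  obtain ⟨s, hs⟩ := hσ
  obtain ⟨t, ht⟩ := hτ
  refine ⟨Functions.apply₂ mulSymbol s t, fun v xs => ?_⟩
  rw [Term.realize_functions_apply₂, hs, ht]
  rfl

theorem IsTermFun.init {τ : (α → M) → (Fin m → M) → M} (hτ : IsTermFun τ) :
    IsTermFun fun v (xs : Fin (m + 1) → M) => τ v (Fin.init xs) := by
  obtain ⟨t, ht⟩ := hτ
  refine ⟨t.relabel (Sum.map id Fin.castSucc), fun v xs => ?_⟩
  rw [Term.realize_relabel]
  refine Eq.trans ?_ (ht _ _)
  congr 1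
  ext i
  cases i <;> rfl

theorem HDefinable.eq {σ τ : (α → M) → (Fin m → M) → M} (hσ : IsTermFun σ) (hτ : IsTermFun τ) :
    HDefinable fun v xs => σ v xs = τ v xs := by
  obtain ⟨s, hs⟩ := hσ
  obtain ⟨t, ht⟩ := hτ
  refine ⟨s.bdEqual t, .atomic (.equal _ _), fun v xs => ?_⟩
  rw [BoundedFormula.realize_bdEqual, hs, ht]

theorem HDefinable.and {P Q : (α → M) → (Fin m → M) → Prop} (hP : HDefinable P)
    (hQ : HDefinable Q) : HDefinable fun v xs => P v xs ∧ Q v xs := by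
  obtain ⟨φ, hφ, hφP⟩ := hP
  obtain ⟨ψ, hψ, hψQ⟩ := hQ
  refine ⟨φ ⊓ ψ, hφ.and hψ, fun v xs => ?_⟩
  rw [BoundedFormula.realize_inf, hφP, hψQ]

theorem HDefinable.ex {P : (α → M) → (Fin m → M) → M → Prop}
    (hP : HDefinable fun v (xs : Fin (m + 1) → M) => P v (Fin.init xs) (xs (Fin.last m))) :
    HDefinable fun v xs => ∃ x, P v xs x := by
  obtain ⟨φ, hφ, hφP⟩ := hP
  refine ⟨φ.ex, hφ.ex, fun v xs => ?_⟩
  simp only [BoundedFormula.realize_ex, hφP, Fin.init_snoc, Fin.snoc_last]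

theorem HDefinable.all {P : (α → M) → (Fin m → M) → M → Prop}
    (hP : HDefinable fun v (xs : Fin (m + 1) → M) => P v (Fin.init xs) (xs (Fin.last m))) :
    HDefinable fun v xs => ∀ x, P v xs x := by
  obtain ⟨φ, hφ, hφP⟩ := hP
  refine ⟨φ.all, hφ.all, fun v xs => ?_⟩
  simp only [BoundedFormula.realize_all, hφP, Fin.init_snoc, Fin.snoc_last]

/-- Relativized universal quantifiers, over a nonempty range. -/
theorem HDefinable.allImp {P Q : (α → M) → (Fin m → M) → M → Prop}
    (hP : HDefinable fun v (xs : Fin (m + 1) → M) => P v (Fin.init xs) (xs (Fin.last m)))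
    (hQ : HDefinable fun v (xs : Fin (m + 1) → M) => Q v (Fin.init xs) (xs (Fin.last m)))
    (hne : ∀ v xs, ∃ x, P v xs x) :
    HDefinable fun v xs => ∀ x, P v xs x → Q v xs x := by
  obtain ⟨φ, hφ, hφP⟩ := hP
  obtain ⟨ψ, hψ, hψQ⟩ := hQ
  refine ⟨_, hφ.exAndAllImp hψ, fun v xs => ?_⟩
  simp only [BoundedFormula.realize_inf, BoundedFormula.realize_ex, BoundedFormula.realize_all,
    BoundedFormula.realize_imp, hφP, hψQ, Fin.init_snoc, Fin.snoc_last, and_iff_right (hne v xs)]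

theorem HDefinable.true : HDefinable fun (_ : α → M) (_ : Fin m → M) => True := by
  simpa using HDefinable.all (P := fun (_ : α → M) (_ : Fin m → M) x => x = x)
    (.eq (.bound _) (.bound _))

theorem HDefinable.forall_finite {κ : Type*} [Finite κ] {P : κ → (α → M) → (Fin m → M) → Prop}
    (hP : ∀ i, HDefinable (P i)) : HDefinable fun v xs => ∀ i, P i v xs := by
  classical
  have := Fintype.ofFinite κ
  have key : ∀ s : Finset κ, HDefinable fun v xs => ∀ i ∈ s, P i v xs := by
    intro s
    induction s using Finset.induction_on with
    | empty => simpa using HDefinable.true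
    | insert a s _ ih => simpa only [Finset.forall_mem_insert] using (hP a).and ih
  simpa using key Finset.univ

theorem HDefinable.exs {P : (α → M) → (Fin m → M) → Prop} (hP : HDefinable P) :
    ∃ φ : groupLang.Formula α, IsHFormula φ ∧ ∀ v, φ.Realize v ↔ ∃ xs, P v xs := by
  obtain ⟨φ, hφ, hφP⟩ := hP
  refine ⟨φ.exs, ?_, fun v => ?_⟩
  · clear hφP P
    induction m with
    | zero => exact hφ
    | succ m ih => exact ih φ.ex hφ.ex
  · rw [BoundedFormula.realize_exs]
    simp only [hφP]

theorem HDefinable.formula {P : (α → M) → Prop}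
    (hP : HDefinable fun v (_ : Fin 0 → M) => P v) :
    ∃ φ : groupLang.Formula α, IsHFormula φ ∧ ∀ v, φ.Realize v ↔ P v := by
  simpa using hP.exs

end HDefinable

/-! ### Products of commutators with a fixed element -/

section CommProd

universe u v

/-- `w` is a product of `N` commutators `f u f⁻¹ u⁻¹`. -/
def CommProd {M : Type u} [Mul M] : ℕ → M → M → Prop
  -- The language has neither identity nor inverse: in a group idempotence says that `w = 1`, and
  -- the equation in the next clause says `w = w' * (f * u * f⁻¹ * u⁻¹)`.
  | 0, w, _ => w * w = w
  | N + 1, w, u => ∃ w' f, CommProd N w' u ∧ w * (u * f) = w' * (f * u)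

theorem HDefinable.commProd {M : Type u} [Mul M] {α : Type v} (N : ℕ) :
    ∀ {m : ℕ} {σ τ : (α → M) → (Fin m → M) → M}, IsTermFun σ → IsTermFun τ →
      HDefinable fun v xs => CommProd N (σ v xs) (τ v xs) := by
  induction N with
  | zero => exact fun hσ _ => .eq (hσ.mul hσ) hσ
  | succ N ih =>
    exact fun hσ hτ => .ex (.ex ((ih (IsTermFun.bound _).init hτ.init.init).and
      (.eq (hσ.init.init.mul (hτ.init.init.mul (.bound _)))
        ((IsTermFun.bound _).init.mul ((IsTermFun.bound _).mul hτ.init.init)))))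

variable {M : Type u} [Group M]

/-- The subgroup generated by the commutators with `u`. -/
def commClosure (u : M) : Subgroup M :=
  Subgroup.closure (Set.range fun f => f * u * f⁻¹ * u⁻¹)

theorem commutator_mem_commClosure (f u : M) : f * u * f⁻¹ * u⁻¹ ∈ commClosure u :=
  Subgroup.subset_closure ⟨f, rfl⟩

theorem commClosure_one : commClosure (1 : M) = ⊥ := by
  simp [commClosure]

theorem commClosure_le (u : M) {K : Subgroup M} (hK : K.Normal) (hu : u ∈ K) :
    commClosure u ≤ K := by
  rw [commClosure, Subgroup.closure_le]
  rintro _ ⟨f, rfl⟩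
  exact K.mul_mem (hK.conj_mem u hu f) (K.inv_mem hu)

/-- With `[f, u] = f u f⁻¹ u⁻¹`, the conjugate of `[f, u]` by `g` is `[g f, u] [g, u]⁻¹`. -/
theorem commClosure_normal (u : M) : (commClosure u).Normal := by
  refine ⟨fun w hw g => ?_⟩
  induction hw using Subgroup.closure_induction with
  | mem x hx =>
    obtain ⟨f, rfl⟩ := hx
    have h : g * (f * u * f⁻¹ * u⁻¹) * g⁻¹ =
      ((g * f) * u * (g * f)⁻¹ * u⁻¹) * (g * u * g⁻¹ * u⁻¹)⁻¹ := by group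
    rw [h]
    exact Subgroup.mul_mem _ (commutator_mem_commClosure _ _)
      (Subgroup.inv_mem _ (commutator_mem_commClosure _ _))
  | one => simp
  | mul x y _ _ hx hy =>
    have h : g * (x * y) * g⁻¹ = (g * x * g⁻¹) * (g * y * g⁻¹) := by group
    rw [h]
    exact Subgroup.mul_mem _ hx hy
  | inv x _ hx =>
    have h : g * x⁻¹ * g⁻¹ = (g * x * g⁻¹)⁻¹ := by group
    rw [h]
    exact Subgroup.inv_mem _ hx

theorem CommProd.mem {N : ℕ} {w u : M} (h : CommProd N w u) : w ∈ commClosure u := by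
  induction N generalizing w with
  | zero =>
    rw [show w = 1 from mul_eq_left.1 h]
    exact Subgroup.one_mem _
  | succ N ih =>
    obtain ⟨w', f, hw', he⟩ := h
    have : w = w' * (f * u * f⁻¹ * u⁻¹) := by
      rw [← mul_right_cancel_iff (a := u * f), he]
      group
    rw [this]
    exact Subgroup.mul_mem _ (ih hw') (commutator_mem_commClosure _ _)

theorem CommProd.one (N : ℕ) (u : M) : CommProd N 1 u := by
  induction N with
  | zero => exact mul_one 1
  | succ N ih => exact ⟨1, 1, ih, by simp⟩

theorem CommProd.mono {N N' : ℕ} (hN : N ≤ N') {w u : M} (h : CommProd N w u) :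
    CommProd N' w u := by
  induction N', hN using Nat.le_induction with
  | base => exact h
  | succ N' _ ih => exact ⟨w, 1, ih, by simp⟩

/-- In a finite group a generated subgroup is already the generated submonoid, so inverses of
commutators are not needed. -/
theorem exists_commProd_of_mem [Finite M] {w u : M} (h : w ∈ commClosure u) :
    ∃ N, CommProd N w u := by
  rw [commClosure, ← Subgroup.mem_toSubmonoid, Subgroup.closure_toSubmonoid_of_finite] at h
  induction h using Submonoid.closure_induction_right with
  | one => exact ⟨0, mul_one 1⟩
  | mul_right x _ y hy ih =>
    obtain ⟨N, hN⟩ := ih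
    obtain ⟨f, rfl⟩ := hy
    exact ⟨N + 1, x, f, hN, by group⟩

/-- Shorter products can be padded with trivial commutators, so the largest length needed over the
finitely many pairs serves for all. This makes membership in `commClosure` a single h-formula. -/
theorem exists_commProd_iff (M : Type u) [Group M] [Finite M] :
    ∃ N, ∀ w u : M, CommProd N w u ↔ w ∈ commClosure u := by
  classical
  have := Fintype.ofFinite M
  have h : ∀ z : M × M, ∃ N, z.1 ∈ commClosure z.2 → CommProd N z.1 z.2 := by
    intro z
    by_cases hz : z.1 ∈ commClosure z.2
    · obtain ⟨N, hN⟩ := exists_commProd_of_mem hz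
      exact ⟨N, fun _ => hN⟩
    · exact ⟨0, fun h => absurd h hz⟩
  choose N hN using h
  exact ⟨Finset.univ.sup N, fun w u => ⟨CommProd.mem, fun hw =>
    (hN (w, u) hw).mono (Finset.le_sup (Finset.mem_univ _))⟩⟩

end CommProd

/-! ### Isolating orbits by h-formulas -/

section Monolith

universe u

/-- `M` is a centreless group, `v ≠ 1`, and every nontrivial normal subgroup of `M` contains `v`
and all commutators of elements of the centralizer of `v`. -/
structure IsMonolithic {M : Type u} [Group M] (v : M) : Prop where
  ne_one : v ≠ 1
  eq_one_of_central : ∀ u : M, (∀ f, f * u = u * f) → u = 1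
  mem : ∀ K : Subgroup M, K.Normal → K ≠ ⊥ → v ∈ K
  commutator_mem : ∀ K : Subgroup M, K.Normal → K ≠ ⊥ → ∀ a b, a * v = v * a → b * v = v * b →
    a * b * a⁻¹ * b⁻¹ ∈ K

variable {M : Type u} [Group M] {v : M}

theorem IsMonolithic.commClosure_ne_bot (hv : IsMonolithic v) {u : M} (hu : u ≠ 1) :
    commClosure u ≠ ⊥ := by
  intro h
  refine hu (hv.eq_one_of_central u fun f => ?_)
  have := commutator_mem_commClosure f u
  rw [h, Subgroup.mem_bot] at this
  rwa [mul_inv_eq_one, mul_inv_eq_iff_eq_mul] at this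

theorem IsMonolithic.commClosure_le (hv : IsMonolithic v) {u : M} (hu : u ≠ 1) :
    commClosure v ≤ commClosure u :=
  SymReducedPower.commClosure_le v (commClosure_normal u)
    (hv.mem _ (commClosure_normal u) (hv.commClosure_ne_bot hu))

theorem IsMonolithic.mem_commClosure (hv : IsMonolithic v) {u : M} (hu : u ≠ 1) :
    v ∈ commClosure u :=
  hv.mem _ (commClosure_normal u) (hv.commClosure_ne_bot hu)

/-- Formulas are invariant under automorphisms. -/
theorem realize_iff_of_mulEquiv (σ : M ≃* M) {α : Type} {a b : α → M} (h : ∀ j, b j = σ (a j))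
    (φ : groupLang.Formula α) : φ.Realize b ↔ φ.Realize a := by
  let τ : M ≃[groupLang] M :=
    { toEquiv := σ.toEquiv
      map_fun' := fun {n} f x => by cases f; exact map_mul σ _ _
      map_rel' := fun {n} r => nomatch r }
  have : b = τ ∘ a := funext h
  rw [this, StrongHomClass.realize_formula]

variable [Finite M]

/-- There is an h-formula that holds at `v` and implies nontriviality. -/
theorem IsMonolithic.exists_nontriviality (hv : IsMonolithic v) :
    ∃ P : M → Prop, P v ∧ ¬ P 1 ∧ ∀ {α : Type} {m : ℕ} {τ : (α → M) → (Fin m → M) → M},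
      IsTermFun τ → HDefinable fun v xs => P (τ v xs) := by
  obtain ⟨N, hN⟩ := exists_commProd_iff M
  refine ⟨fun x => ∀ a, a * x = x * a → ∀ b, b * x = x * b →
    ∃ c, c * (b * a) = a * b ∧ CommProd N c x, ?_, ?_, ?_⟩
  · intro a ha b hb
    refine ⟨a * b * a⁻¹ * b⁻¹, by group, (hN _ _).2 ?_⟩
    exact hv.commutator_mem _ (commClosure_normal v) (hv.commClosure_ne_bot hv.ne_one) a b ha hb
  -- At `1` the centralizer is the whole group and `commClosure` is trivial, so the property would
  -- make the group abelian, and `v` central.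
  · intro h
    refine hv.ne_one (hv.eq_one_of_central v fun a => ?_)
    obtain ⟨c, hc, hc'⟩ := h a (by simp) v (by simp)
    have := hc'.mem
    rw [commClosure_one, Subgroup.mem_bot] at this
    rw [← hc, this, one_mul]
  · intro α m τ hτ
    refine .allImp (.eq ((IsTermFun.bound _).mul hτ.init) (hτ.init.mul (.bound _)))
      (.allImp (.eq ((IsTermFun.bound _).mul hτ.init.init) (hτ.init.init.mul (.bound _)))
        (.ex (.and (.eq ((IsTermFun.bound _).mul
          ((IsTermFun.bound _).init.mul (IsTermFun.bound _).init.init))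
          ((IsTermFun.bound _).init.init.mul (IsTermFun.bound _).init))
          (.commProd N (.bound _) hτ.init.init.init))) ?_) ?_
    -- The relativized quantifier of h-formulas also asserts that its range is nonempty; a
    -- centralizer always contains `1`.
    · exact fun _ _ => ⟨1, by simp⟩
    · exact fun _ _ => ⟨1, by simp⟩

/-- The orbits of tuples under automorphisms are definable by h-formulas. -/
theorem IsMonolithic.exists_hFormula_orbit (hv : IsMonolithic v) {α : Type} [Finite α]
    (a : α → M) : ∃ φ : groupLang.Formula α, IsHFormula φ ∧
      ∀ b : α → M, φ.Realize b ↔ ∃ σ : M ≃* M, ∀ j, b j = σ (a j) := by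
  obtain ⟨P, hPv, hP1, hP⟩ := hv.exists_nontriviality
  obtain ⟨m, ⟨e⟩⟩ := Finite.exists_equiv_fin M
  -- The variables `ys` are the values of an endomorphism of `M`, which sends `a` to `b` and keeps
  -- `v` nontrivial.
  have key : HDefinable fun (b : α → M) (ys : Fin m → M) =>
      (∀ gh : M × M, ys (e gh.1) * ys (e gh.2) = ys (e (gh.1 * gh.2))) ∧
      (∀ j, b j = ys (e (a j))) ∧ P (ys (e v)) :=
    .and (.forall_finite fun _ => .eq ((IsTermFun.bound _).mul (.bound _)) (.bound _))
      (.and (.forall_finite fun _ => .eq (.free _) (.bound _)) (hP (.bound _)))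
  obtain ⟨φ, hφ, hφ'⟩ := key.exs
  refine ⟨φ, hφ, fun b => ?_⟩
  rw [hφ']
  constructor
  · rintro ⟨ys, hmul, hb, hPy⟩
    let σ : M →* M := MonoidHom.mk' (fun g => ys (e g)) fun g h => (hmul (g, h)).symm
    have hinj : Function.Injective σ := by
      rw [← MonoidHom.ker_eq_bot_iff]
      by_contra hne
      have hmem := hv.mem σ.ker inferInstance hne
      rw [MonoidHom.mem_ker] at hmem
      exact hP1 (hmem ▸ hPy)
    exact ⟨MulEquiv.ofBijective σ (Finite.injective_iff_bijective.1 hinj), hb⟩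
  · rintro ⟨σ, hσ⟩
    -- The tuple `a` satisfies the formula through the identity endomorphism; truth is then carried
    -- along `σ`.
    have hrealize := (hφ' a).2 ⟨fun i => e.symm i, by simp, by simp, by simpa using hPv⟩
    refine (hφ' b).1 ?_
    exact (realize_iff_of_mulEquiv σ hσ φ).2 hrealize

end Monolith

/-! ### Reduced powers and truth at almost all coordinates -/

section
universe u v w
variable {ι : Type u} (𝓘 : Order.Ideal (Set ι))

theorem mk_eq_mk_iff {M : Type v} {f g : ι → M} :
    ReducedPower.mk 𝓘 f = ReducedPower.mk 𝓘 g ↔ {i | f i ≠ g i} ∈ 𝓘 :=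
  Quotient.eq (r := powerSetoid 𝓘 M)

theorem mk_out {M : Type v} (x : ReducedPower 𝓘 M) :
    ReducedPower.mk 𝓘 (Quotient.out x) = x :=
  Quotient.out_eq x

theorem mk_mul {M : Type v} [Mul M] (f g : ι → M) :
    ReducedPower.mk 𝓘 f * ReducedPower.mk 𝓘 g = ReducedPower.mk 𝓘 fun i => f i * g i :=
  rfl

theorem term_realize_mk {M : Type v} [Mul M] {α : Type w} (t : groupLang.Term α) (f : α → ι → M) :
    t.realize (fun a => ReducedPower.mk 𝓘 (f a)) =
      ReducedPower.mk 𝓘 fun i => t.realize fun a => f a i := by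
  induction t with
  | var a => rfl
  | func F ts ih =>
    cases F
    change Term.realize _ (ts 0) * Term.realize _ (ts 1) = _
    rw [ih, ih, mk_mul]
    rfl

theorem snoc_mk {M : Type v} {m : ℕ} (g : Fin m → ι → M) (x : ι → M) :
    (Fin.snoc (fun j => ReducedPower.mk 𝓘 (g j)) (ReducedPower.mk 𝓘 x) :
      Fin (m + 1) → ReducedPower 𝓘 M) =
      fun j => ReducedPower.mk 𝓘 ((Fin.snoc g x : Fin (m + 1) → ι → M) j) := by
  ext j
  refine Fin.lastCases ?_ (fun j => ?_) j <;> simp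

theorem snoc_apply_coord {M : Type v} {m : ℕ} (g : Fin m → ι → M) (x : ι → M) (i : ι) :
    (fun j => (Fin.snoc g x : Fin (m + 1) → ι → M) j i) = Fin.snoc (fun j => g j i) (x i) := by
  ext j
  refine Fin.lastCases ?_ (fun j => ?_) j <;> simp

/-- This puts the induction hypothesis of the quantifier cases into a form where the quantified
element is the class of an explicit sequence. -/
theorem realize_snoc_mk_iff {M : Type v} [Mul M] {α : Type w} {m : ℕ}
    {φ : groupLang.BoundedFormula α (m + 1)} {f : α → ι → M}
    (ih : ∀ g : Fin (m + 1) → ι → M,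
      φ.Realize (fun a => ReducedPower.mk 𝓘 (f a)) (fun j => ReducedPower.mk 𝓘 (g j)) ↔
        {i | ¬ φ.Realize (fun a => f a i) fun j => g j i} ∈ 𝓘)
    (g : Fin m → ι → M) (x : ι → M) :
    φ.Realize (fun a => ReducedPower.mk 𝓘 (f a))
        (Fin.snoc (fun j => ReducedPower.mk 𝓘 (g j)) (ReducedPower.mk 𝓘 x)) ↔
      {i | ¬ φ.Realize (fun a => f a i) (Fin.snoc (fun j => g j i) (x i))} ∈ 𝓘 := by
  rw [snoc_mk]
  refine (ih _).trans ?_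
  simp only [snoc_apply_coord]

theorem almostAll_mono {p q : ι → Prop} (hp : {i | ¬ p i} ∈ 𝓘) (h : ∀ i, p i → q i) :
    {i | ¬ q i} ∈ 𝓘 :=
  𝓘.lower (fun i hi hc => hi (h i hc)) hp

theorem almostAll_mono₂ {p q r : ι → Prop} (hp : {i | ¬ p i} ∈ 𝓘) (hq : {i | ¬ q i} ∈ 𝓘)
    (h : ∀ i, p i → q i → r i) : {i | ¬ r i} ∈ 𝓘 := by
  refine 𝓘.lower (fun i hi => ?_) (Order.Ideal.sup_mem hp hq)
  by_contra hc
  simp only [Set.sup_eq_union, Set.mem_union, Set.mem_ofPred_eq, not_or, not_not] at hc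
  exact hi (h i hc.1 hc.2)

/-- h-formulas hold in a reduced power if and only if they hold at almost all coordinates. -/
theorem IsHFormula.realize_mk_iff {M : Type v} [Mul M] [Nonempty M] {α : Type w} {m : ℕ}
    {φ : groupLang.BoundedFormula α m} (hφ : IsHFormula φ) (f : α → ι → M) (g : Fin m → ι → M) :
    φ.Realize (fun a => ReducedPower.mk 𝓘 (f a)) (fun j => ReducedPower.mk 𝓘 (g j)) ↔
      {i | ¬ φ.Realize (fun a => f a i) fun j => g j i} ∈ 𝓘 := by
  induction hφ with
  | atomic h =>
    cases h with
    | equal s t =>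
      have key : (Sum.elim (fun a => ReducedPower.mk 𝓘 (f a)) fun j => ReducedPower.mk 𝓘 (g j)) =
          fun c => ReducedPower.mk 𝓘 (Sum.elim f g c) := by
        ext c
        cases c <;> rfl
      have key' : ∀ i, (Sum.elim (fun a => f a i) fun j => g j i) = fun c => Sum.elim f g c i := by
        intro i
        ext c
        cases c <;> rfl
      simp only [BoundedFormula.realize_bdEqual, key, key', term_realize_mk, mk_eq_mk_iff, ne_eq]
    | rel R => exact nomatch R
  | and _ _ ih₁ ih₂ =>
    simp only [BoundedFormula.realize_inf, ih₁, ih₂]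
    exact ⟨fun h => almostAll_mono₂ 𝓘 h.1 h.2 fun i => And.intro,
      fun h => ⟨almostAll_mono 𝓘 h fun i => And.left, almostAll_mono 𝓘 h fun i => And.right⟩⟩
  | @ex m φ _ ih =>
    have ih := realize_snoc_mk_iff 𝓘 ih g
    simp only [BoundedFormula.realize_ex]
    constructor
    · rintro ⟨x, hx⟩
      rw [← mk_out 𝓘 x] at hx
      exact almostAll_mono 𝓘 ((ih (Quotient.out x)).1 hx) fun i h => ⟨_, h⟩
    · intro h
      -- Witnesses are chosen coordinatewise; at the negligible set of coordinates without a witness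
      -- the value is arbitrary.
      exact ⟨_, (ih fun i => Classical.epsilon fun x =>
        φ.Realize (fun a => f a i) (Fin.snoc (fun j => g j i) x)).2
        (almostAll_mono 𝓘 h fun i h => Classical.epsilon_spec h)⟩
  | @all m φ _ ih =>
    have ih := realize_snoc_mk_iff 𝓘 ih g
    simp only [BoundedFormula.realize_all]
    constructor
    · intro h
      -- The universal statement is tested at a sequence that picks a counterexample at every
      -- coordinate where there is one.
      refine almostAll_mono 𝓘 ((ih fun i => Classical.epsilon fun x =>
          ¬ φ.Realize (fun a => f a i) (Fin.snoc (fun j => g j i) x)).1 (h _))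
        fun i h x => by_contra fun hx => ?_
      exact Classical.epsilon_spec (p := fun x =>
          ¬ φ.Realize (fun a => f a i) (Fin.snoc (fun j => g j i) x)) ⟨x, hx⟩ h
    · intro h x
      rw [← mk_out 𝓘 x]
      exact (ih (Quotient.out x)).2 (almostAll_mono 𝓘 h fun i h => h _)
  | @exAndAllImp m φ ψ _ _ ihφ ihψ =>
    have ihφ := realize_snoc_mk_iff 𝓘 ihφ g
    have ihψ := realize_snoc_mk_iff 𝓘 ihψ g
    simp only [BoundedFormula.realize_inf, BoundedFormula.realize_ex, BoundedFormula.realize_all,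
      BoundedFormula.realize_imp]
    constructor
    · rintro ⟨⟨z, hz⟩, h⟩
      rw [← mk_out 𝓘 z] at hz
      replace hz := (ihφ (Quotient.out z)).1 hz
      -- A worst choice: `x i` satisfies `φ`, and violates `ψ` as soon as some element satisfying
      -- `φ` does. The conjunct `∃ x, φ` ensures that such a choice exists at almost all
      -- coordinates, so `x` satisfies `φ` in the reduced power.
      let x : ι → M := fun i => Classical.epsilon fun x =>
        φ.Realize (fun a => f a i) (Fin.snoc (fun j => g j i) x) ∧
          (ψ.Realize (fun a => f a i) (Fin.snoc (fun j => g j i) x) →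
            ∀ x, φ.Realize (fun a => f a i) (Fin.snoc (fun j => g j i) x) →
              ψ.Realize (fun a => f a i) (Fin.snoc (fun j => g j i) x))
      have hx : ∀ i, (∃ x, φ.Realize (fun a => f a i) (Fin.snoc (fun j => g j i) x)) →
          φ.Realize (fun a => f a i) (Fin.snoc (fun j => g j i) (x i)) ∧
          (ψ.Realize (fun a => f a i) (Fin.snoc (fun j => g j i) (x i)) →
            ∀ x, φ.Realize (fun a => f a i) (Fin.snoc (fun j => g j i) x) →
              ψ.Realize (fun a => f a i) (Fin.snoc (fun j => g j i) x)) := by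
        rintro i ⟨y, hy⟩
        refine Classical.epsilon_spec (p := fun x =>
          φ.Realize (fun a => f a i) (Fin.snoc (fun j => g j i) x) ∧
          (ψ.Realize (fun a => f a i) (Fin.snoc (fun j => g j i) x) →
            ∀ x, φ.Realize (fun a => f a i) (Fin.snoc (fun j => g j i) x) →
              ψ.Realize (fun a => f a i) (Fin.snoc (fun j => g j i) x))) ?_
        by_cases hi : ∀ x, φ.Realize (fun a => f a i) (Fin.snoc (fun j => g j i) x) →
              ψ.Realize (fun a => f a i) (Fin.snoc (fun j => g j i) x)
        · exact ⟨y, hy, fun _ => hi⟩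
        · push Not at hi
          obtain ⟨x, hx, hx'⟩ := hi
          exact ⟨x, hx, fun h => absurd h hx'⟩
      have h := (ihψ _).1 (h (ReducedPower.mk 𝓘 x) ((ihφ _).2
        (almostAll_mono 𝓘 hz fun i h => (hx i ⟨_, h⟩).1)))
      exact almostAll_mono₂ 𝓘 hz h fun i hi hi' => ⟨⟨_, hi⟩, (hx i ⟨_, hi⟩).2 hi'⟩
    · intro h
      constructor
      · exact ⟨_, (ihφ fun i => Classical.epsilon fun x =>
        φ.Realize (fun a => f a i) (Fin.snoc (fun j => g j i) x)).2
        (almostAll_mono 𝓘 h fun i h => Classical.epsilon_spec h.1)⟩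
      · intro x hx
        rw [← mk_out 𝓘 x] at hx ⊢
        exact (ihψ (Quotient.out x)).2 (almostAll_mono₂ 𝓘 h ((ihφ (Quotient.out x)).1 hx)
          fun i hi hi' => hi.2 _ hi')

theorem IsHFormula.realize_formula_mk_iff {M : Type v} [Mul M] [Nonempty M] {α : Type w}
    {φ : groupLang.Formula α} (hφ : IsHFormula φ) (f : α → ι → M) :
    φ.Realize (fun a => ReducedPower.mk 𝓘 (f a)) ↔ {i | ¬ φ.Realize fun a => f a i} ∈ 𝓘 := by
  have := hφ.realize_mk_iff 𝓘 f Fin.elim0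
  simp only [Formula.Realize]
  convert this using 6

end

/-! ### Types -/
section Types
universe u v
variable {M : Type} [Group M]

theorem equivSentence_mem_iff_realize {α : Type} {a : α → M} {φ : groupLang.Formula α} :
    Formula.equivSentence φ ∈ (groupLang.completeTheory M).typeOf a ↔ φ.Realize a := by
  simp

/-- If no tuple realizes `q`, every one of the finitely many tuples violates some formula of `q`.
The conjunction of these formulas is satisfied in a model of the theory but by no tuple of `M`,
against completeness. -/
theorem exists_typeOf_eq [Finite M] {α : Type} [Finite α]
    (q : (groupLang.completeTheory M).CompleteType α) :
    ∃ a : α → M, (groupLang.completeTheory M).typeOf a = q := by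
  classical
  by_contra! hcon
  have h : ∀ a : α → M, ∃ φ : groupLang.Formula α,
      Formula.equivSentence φ ∈ q ∧ ¬ φ.Realize a := by
    intro a
    by_contra! hc
    refine hcon a (SetLike.ext fun φ => ?_)
    obtain ⟨φ, rfl⟩ := Formula.equivSentence.surjective φ
    rw [equivSentence_mem_iff_realize]
    refine ⟨fun h => ?_, fun h => hc _ h⟩
    by_contra hn
    rw [← Theory.CompleteType.not_mem_iff, ← Formula.equivSentence_not] at hn
    exact (Formula.realize_not.1 (hc _ hn)) h
  choose φ hφ hφ' using h
  obtain ⟨N⟩ := q.isMaximal.1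
  let := (groupLang.lhomWithConstants α).reduct N
  have hN : ∀ ψ : groupLang.Formula α, Formula.equivSentence ψ ∈ q →
      ψ.Realize fun a => (groupLang.con a : N) := fun ψ hψ => by
    rw [← Formula.realize_equivSentence]
    exact N.is_model.realize_of_mem _ hψ
  have hT : N ⊨ groupLang.completeTheory M :=
    (LHom.onTheory_model _ _).1 (N.is_model.mono q.subset)
  let χ : groupLang.Formula α := BoundedFormula.iInf φ
  have hχ : M ⊨ χ.exClosure.not := by
    rw [Sentence.realize_not, ← Formula.exists_realize_equivSentence_iff_realize_exClosure]
    rintro ⟨a, ha⟩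
    let := constantsOn.structure a
    rw [Formula.realize_equivSentence] at ha
    exact hφ' a (BoundedFormula.realize_iInf.1 ha a)
  refine (Sentence.realize_not N).1 (hT.realize_of_mem χ.exClosure.not hχ) ?_
  refine Formula.realize_exClosure_of_realize_equivSentence
    ((Formula.realize_equivSentence _ _).2 ?_)
  exact BoundedFormula.realize_iInf.2 fun a => hN _ (hφ a)

end Types

/-! ### The symmetric group -/

section Perm

open Equiv

/-- If `u` moves `a`, take a third point `c`: the transposition of `u a` and `c` fixes `a` but not
`u a`, so it does not commute with `u`. -/
theorem perm_eq_one_of_central {n : ℕ} (hn : 3 ≤ n) (u : Perm (Fin n))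
    (hu : ∀ f, f * u = u * f) : u = 1 := by
  ext a
  by_contra hne
  rw [Fin.val_inj, Perm.one_apply] at hne
  obtain ⟨c, hc⟩ : ∃ c, c ∉ ({a, u a} : Finset (Fin n)) := by
    by_contra! h
    have h₁ := Finset.card_le_card (fun c _ => h c : (Finset.univ : Finset (Fin n)) ⊆ _)
    have h₂ := Finset.card_le_two (a := a) (b := u a)
    rw [Finset.card_univ, Fintype.card_fin] at h₁
    omega
  simp only [Finset.mem_insert, Finset.mem_singleton, not_or] at hc
  have h := congrArg (fun g : Perm (Fin n) => g a) (hu (swap (u a) c))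
  simp only [Perm.mul_apply, swap_apply_left,
    swap_apply_of_ne_of_ne (Ne.symm hne) (Ne.symm hc.1)] at h
  exact hc.2 h

/-- The centralizer of a double transposition is dihedral of order 8, and its commutator subgroup is
generated by that double transposition. -/
theorem commutator_centralizer_four : ∀ a b : Perm (Fin 4),
    a * (swap 0 1 * swap 2 3) = swap 0 1 * swap 2 3 * a →
    b * (swap 0 1 * swap 2 3) = swap 0 1 * swap 2 3 * b →
    a * b * a⁻¹ * b⁻¹ = 1 ∨ a * b * a⁻¹ * b⁻¹ = swap 0 1 * swap 2 3 := by
  decide +kernel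

/-- Consequently a normal subgroup containing a nontrivial `u` contains the double transposition. -/
theorem exists_conj_commutator_four : ∀ u : Perm (Fin 4), u ≠ 1 →
    ∃ g f : Perm (Fin 4), g * (f * u * f⁻¹ * u⁻¹) * g⁻¹ = swap 0 1 * swap 2 3 := by
  decide +kernel

theorem isMonolithic_perm_four : IsMonolithic (swap 0 1 * swap 2 3 : Perm (Fin 4)) := by
  have hmem : ∀ K : Subgroup (Perm (Fin 4)), K.Normal → K ≠ ⊥ → swap 0 1 * swap 2 3 ∈ K := by
    intro K hK hne
    obtain ⟨u, hu, hu1⟩ := K.bot_or_exists_ne_one.resolve_left hne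
    obtain ⟨g, f, h⟩ := exists_conj_commutator_four u hu1
    rw [← h]
    exact hK.conj_mem _ (K.mul_mem (hK.conj_mem u hu f) (K.inv_mem hu)) g
  refine ⟨by decide, perm_eq_one_of_central (by norm_num), hmem, fun K hK hne a b ha hb => ?_⟩
  rcases commutator_centralizer_four a b ha hb with h | h
  · exact h ▸ K.one_mem
  · exact h ▸ hmem K hK hne

/-- Every nontrivial normal subgroup contains the alternating group, which contains `v` and all
commutators. -/
theorem isMonolithic_perm_of_five_le {n : ℕ} (hn : 5 ≤ n) {v : Perm (Fin n)} (hv : v ≠ 1)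
    (hsign : Perm.sign v = 1) : IsMonolithic v := by
  have hle : ∀ K : Subgroup (Perm (Fin n)), K.Normal → K ≠ ⊥ → alternatingGroup (Fin n) ≤ K := by
    intro K hK hne
    exact Perm.alternatingGroup_le_of_normal (by simpa using hn) (K.nontrivial_iff_ne_bot.2 hne)
  exact ⟨hv, perm_eq_one_of_central (by omega),
    fun K hK hne => hle K hK hne (Perm.mem_alternatingGroup.2 hsign),
    fun K hK hne a b _ _ => hle K hK hne (Perm.mem_alternatingGroup.2 (by
      rw [map_mul, map_mul, map_mul, map_inv, map_inv, mul_inv_cancel_comm, mul_inv_cancel]))⟩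

theorem exists_isMonolithic_perm {n : ℕ} (hn : 4 ≤ n) : ∃ v : Perm (Fin n), IsMonolithic v := by
  obtain rfl | hn : 4 = n ∨ 5 ≤ n := by omega
  · exact ⟨_, isMonolithic_perm_four⟩
  · let i : Fin 5 → Fin n := Fin.castLE hn
    have h : ∀ a b : Fin 5, a ≠ b → i a ≠ i b := fun a b hab h => hab (Fin.castLE_injective hn h)
    refine ⟨swap (i 0) (i 1) * swap (i 2) (i 3), isMonolithic_perm_of_five_le hn (fun he => ?_) ?_⟩
    · have := congrArg (fun g : Perm (Fin n) => g (i 0)) he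
      simp only [Perm.mul_apply, Perm.one_apply, swap_apply_left,
        swap_apply_of_ne_of_ne (h 0 2 (by decide)) (h 0 3 (by decide))] at this
      exact h 1 0 (by decide) this
    · simp [Perm.sign_swap (h 0 1 (by decide)), Perm.sign_swap (h 2 3 (by decide))]

end Perm

/-! ### Types as orbits -/

section Types

variable {M : Type} [Group M] {v : M} {k : ℕ}

/-- The complete type of a tuple. -/
abbrev tupleType (a : Fin k → M) :
    (groupLang.completeTheory M).CompleteType (Fin k) :=
  (groupLang.completeTheory M).typeOf a

theorem Isolates.realize_iff {φ : groupLang.Formula (Fin k)}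
    {p : (groupLang.completeTheory M).CompleteType (Fin k)} (hφ : Isolates φ p) (a : Fin k → M) :
    φ.Realize a ↔ tupleType a = p := by
  rw [← hφ, equivSentence_mem_iff_realize]

variable [Finite M]

/-- The orbit of `a` is defined by a formula, which belongs to the type of `a`; conversely
automorphisms preserve types. -/
theorem IsMonolithic.tupleType_eq_iff (hv : IsMonolithic v) {a b : Fin k → M} :
    tupleType b = tupleType a ↔ ∃ σ : M ≃* M, ∀ j, b j = σ (a j) := by
  obtain ⟨φ, -, hφ⟩ := hv.exists_hFormula_orbit a
  constructor
  · intro h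
    rw [← hφ, ← equivSentence_mem_iff_realize, show (groupLang.completeTheory M).typeOf b = _ from h,
      equivSentence_mem_iff_realize, hφ]
    exact ⟨MulEquiv.refl M, fun _ => rfl⟩
  · rintro ⟨σ, hσ⟩
    refine SetLike.ext fun ψ => ?_
    obtain ⟨ψ, rfl⟩ := Formula.equivSentence.surjective ψ
    rw [equivSentence_mem_iff_realize, equivSentence_mem_iff_realize, realize_iff_of_mulEquiv σ hσ]

theorem IsMonolithic.exists_isolating (hv : IsMonolithic v)
    (p : (groupLang.completeTheory M).CompleteType (Fin k)) :
    ∃ φ : groupLang.Formula (Fin k), IsHFormula φ ∧ Isolates φ p := by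
  obtain ⟨a, rfl⟩ := exists_typeOf_eq p
  obtain ⟨φ, hφ, hφ'⟩ := hv.exists_hFormula_orbit a
  refine ⟨φ, hφ, fun q => ?_⟩
  obtain ⟨b, rfl⟩ := exists_typeOf_eq q
  rw [equivSentence_mem_iff_realize, hφ', hv.tupleType_eq_iff]

instance : Finite ((groupLang.completeTheory M).CompleteType (Fin k)) :=
  Finite.of_surjective tupleType exists_typeOf_eq

/-- Types of extended tuples restrict to types of tuples, and extensions of types are realized
over every realization. -/
theorem IsMonolithic.exists_restriction (hv : IsMonolithic v) (k : ℕ) :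
    ∃ r : (groupLang.completeTheory M).CompleteType (Fin (k + 1)) →
        (groupLang.completeTheory M).CompleteType (Fin k),
      ∀ (a : Fin k → M) q, tupleType a = r q ↔ ∃ g, tupleType (Fin.snoc a g : Fin (k + 1) → M) = q := by
  choose c hc using exists_typeOf_eq (M := M) (α := Fin (k + 1))
  refine ⟨fun q => tupleType (Fin.init (c q)), fun a q => ?_⟩
  have h : ∀ b, tupleType b = q ↔ ∃ σ : M ≃* M, ∀ j, b j = σ (c q j) := fun b => by
    rw [← hv.tupleType_eq_iff, show tupleType (c q) = q from hc q]
  simp only [h, hv.tupleType_eq_iff]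
  constructor
  · rintro ⟨σ, hσ⟩
    -- The automorphism taking the restricted realization of `q` to `a` also moves its last entry,
    -- and this gives the extension.
    refine ⟨σ (c q (Fin.last k)), σ, fun j => ?_⟩
    refine Fin.lastCases ?_ (fun j => ?_) j
    · simp
    · simpa [Fin.init] using hσ j
  · rintro ⟨g, σ, hσ⟩
    exact ⟨σ, fun j => by simpa [Fin.init] using hσ j.castSucc⟩

end Types

/-! ### The quotient algebra -/

section QuotAlg

universe u v w

variable {ι : Type u} (𝓘 : Order.Ideal (Set ι))

theorem QuotAlg.mk_surjective (c : QuotAlg 𝓘) : ∃ A, QuotAlg.mk 𝓘 A = c :=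
  Quotient.exists_rep c

theorem mk_le_mk_iff {p q : ι → Prop} :
    QuotAlg.mk 𝓘 {i | p i} ≤ QuotAlg.mk 𝓘 {i | q i} ↔ {i | ¬ (p i → q i)} ∈ 𝓘 := by
  have : ({i | p i} \ {i | q i} : Set ι) = {i | ¬ (p i → q i)} := by
    ext i
    simp
  rw [← this]
  rfl

theorem quotAlg_mk_eq_mk_iff {p q : ι → Prop} :
    QuotAlg.mk 𝓘 {i | p i} = QuotAlg.mk 𝓘 {i | q i} ↔ {i | ¬ (p i ↔ q i)} ∈ 𝓘 := by
  have : (symmDiff {i | p i} {i | q i} : Set ι) = {i | ¬ (p i ↔ q i)} := by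
    ext i
    simp only [Set.mem_symmDiff, Set.mem_ofPred_eq]
    tauto
  rw [← this]
  exact Quotient.eq (r := setSetoid 𝓘)

theorem quotAlg_le_refl (c : QuotAlg 𝓘) : c ≤ c := by
  obtain ⟨A, rfl⟩ := QuotAlg.mk_surjective 𝓘 c
  exact (mk_le_mk_iff 𝓘 (p := (· ∈ A)) (q := (· ∈ A))).2 (by simpa using 𝓘.bot_mem)

theorem quotAlg_le_antisymm {c d : QuotAlg 𝓘} (h₁ : c ≤ d) (h₂ : d ≤ c) : c = d := by
  obtain ⟨A, rfl⟩ := QuotAlg.mk_surjective 𝓘 c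
  obtain ⟨B, rfl⟩ := QuotAlg.mk_surjective 𝓘 d
  exact (quotAlg_mk_eq_mk_iff 𝓘 (p := (· ∈ A)) (q := (· ∈ B))).2
    (almostAll_mono₂ 𝓘 ((mk_le_mk_iff 𝓘).1 h₁) ((mk_le_mk_iff 𝓘).1 h₂) fun i => Iff.intro)

theorem quotAlg_le_trans {c d e : QuotAlg 𝓘} (h₁ : c ≤ d) (h₂ : d ≤ e) : c ≤ e := by
  obtain ⟨A, rfl⟩ := QuotAlg.mk_surjective 𝓘 c
  obtain ⟨B, rfl⟩ := QuotAlg.mk_surjective 𝓘 d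
  obtain ⟨C, rfl⟩ := QuotAlg.mk_surjective 𝓘 e
  exact (mk_le_mk_iff 𝓘 (p := (· ∈ A)) (q := (· ∈ C))).2
    (almostAll_mono₂ 𝓘 ((mk_le_mk_iff 𝓘).1 h₁) ((mk_le_mk_iff 𝓘).1 h₂) fun i h h' hi => h' (h hi))

theorem almostAll_of_forall {p : ι → Prop} (h : ∀ i, p i) : {i | ¬ p i} ∈ 𝓘 :=
  𝓘.lower (fun i hi => absurd (h i) hi) 𝓘.bot_mem

theorem almostAll_forall {κ : Type w} [Finite κ] {p : κ → ι → Prop}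
    (h : ∀ j, {i | ¬ p j i} ∈ 𝓘) : {i | ¬ ∀ j, p j i} ∈ 𝓘 := by
  classical
  have := Fintype.ofFinite κ
  have key : ∀ s : Finset κ, {i | ¬ ∀ j ∈ s, p j i} ∈ 𝓘 := by
    intro s
    induction s using Finset.induction_on with
    | empty => exact almostAll_of_forall 𝓘 (by simp)
    | insert a s _ ih =>
      exact almostAll_mono₂ 𝓘 (h a) ih fun i h h' => (Finset.forall_mem_insert _ _ _).2 ⟨h, h'⟩
  exact almostAll_mono 𝓘 (key Finset.univ) fun i h j => h j (Finset.mem_univ j)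

theorem exists_mk_eq {M : Type v} {κ : Type w} (x : κ → ReducedPower 𝓘 M) :
    ∃ f : κ → ι → M, x = fun j => ReducedPower.mk 𝓘 (f j) :=
  ⟨fun j => Quotient.out (x j), funext fun j => (mk_out 𝓘 (x j)).symm⟩

end QuotAlg

/-! ### Predicates definable without parameters -/

section DefinablePred

universe u v w

variable (L : FirstOrder.Language.{0, 0}) {N : Type u} [L.Structure N] {γ : Type v}

/-- A predicate of finitely many variables that is definable without parameters. -/
def DefinablePred (P : (γ → N) → Prop) : Prop := (∅ : Set N).Definable L {z | P z}

variable {L}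

theorem DefinablePred.realize (φ : L.Formula γ) : DefinablePred L (N := N) φ.Realize :=
  Set.empty_definable_iff.2 ⟨φ, rfl⟩

theorem DefinablePred.congr {P Q : (γ → N) → Prop} (hP : DefinablePred L P)
    (h : ∀ z, P z ↔ Q z) : DefinablePred L Q := by
  rwa [← show P = Q from funext fun z => propext (h z)]

theorem DefinablePred.comp {δ : Type w} {P : (δ → N) → Prop} (hP : DefinablePred L P) (c : δ → γ) :
    DefinablePred L fun z : γ → N => P fun j => z (c j) :=
  hP.preimage_comp c

theorem DefinablePred.not {P : (γ → N) → Prop} (hP : DefinablePred L P) :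
    DefinablePred L fun z => ¬ P z :=
  hP.compl

theorem DefinablePred.and {P Q : (γ → N) → Prop} (hP : DefinablePred L P)
    (hQ : DefinablePred L Q) : DefinablePred L fun z => P z ∧ Q z :=
  hP.inter hQ

theorem DefinablePred.imp {P Q : (γ → N) → Prop} (hP : DefinablePred L P)
    (hQ : DefinablePred L Q) : DefinablePred L fun z => P z → Q z := by
  simpa only [not_and, not_not] using (hP.and hQ.not).not

theorem DefinablePred.iff {P Q : (γ → N) → Prop} (hP : DefinablePred L P)
    (hQ : DefinablePred L Q) : DefinablePred L fun z => P z ↔ Q z := by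
  simpa only [iff_iff_implies_and_implies] using (hP.imp hQ).and (hQ.imp hP)

theorem DefinablePred.false : DefinablePred L fun _ : γ → N => False :=
  Set.definable_empty

theorem DefinablePred.forall_finite {κ : Type*} [Finite κ] {P : κ → (γ → N) → Prop}
    (hP : ∀ j, DefinablePred L (P j)) : DefinablePred L fun z => ∀ j, P j z := by
  have := Set.definable_iInter_of_finite hP
  rwa [← Set.ofPred_forall] at this

theorem DefinablePred.alls {δ : Type w} [Finite δ] {P : (γ → N) → (δ → N) → Prop}
    (hP : DefinablePred L fun z : γ ⊕ δ → N => P (fun a => z (Sum.inl a)) fun d => z (Sum.inr d)) :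
    DefinablePred L fun z => ∀ w, P z w :=
  Set.Definable.forall_of_finite hP

theorem DefinablePred.exs {δ : Type w} [Finite δ] {P : (γ → N) → (δ → N) → Prop}
    (hP : DefinablePred L fun z : γ ⊕ δ → N => P (fun a => z (Sum.inl a)) fun d => z (Sum.inr d)) :
    DefinablePred L fun z => ∃ w, P z w :=
  Set.Definable.exists_of_finite hP

theorem DefinablePred.all {P : (γ → N) → N → Prop}
    (hP : DefinablePred L fun z : γ ⊕ Unit → N => P (fun a => z (Sum.inl a)) (z (Sum.inr ()))) :
    DefinablePred L fun z => ∀ w, P z w := by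
  have h := DefinablePred.alls (δ := Unit) (P := fun z w => P z (w ())) hP
  convert h using 2
  exact ⟨fun h w => h _, fun h w => h fun _ => w⟩

theorem DefinablePred.ex {P : (γ → N) → N → Prop}
    (hP : DefinablePred L fun z : γ ⊕ Unit → N => P (fun a => z (Sum.inl a)) (z (Sum.inr ()))) :
    DefinablePred L fun z => ∃ w, P z w := by
  have h := DefinablePred.exs (δ := Unit) (P := fun z w => P z (w ())) hP
  convert h using 2
  exact ⟨fun ⟨w, h⟩ => ⟨fun _ => w, h⟩, fun ⟨w, h⟩ => ⟨w (), h⟩⟩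

theorem DefinablePred.mul_eq {G : Type u} [Mul G] (a b c : γ) :
    DefinablePred groupLang fun z : γ → G => z a * z b = z c := by
  have h := DefinablePred.realize (N := G) (Term.equal
    (Functions.apply₂ mulSymbol (Term.var a) (Term.var b)) (Term.var c))
  convert h using 2
  rw [Formula.realize_equal, Term.realize_functions_apply₂]
  rfl

end DefinablePred

/-! ### Interpreting the quotient algebra -/

section Interpretation

universe u

variable {ι : Type u} (𝓘 : Order.Ideal (Set ι)) {M : Type} [Group M] {v : M}

/-- The class of the set of coordinates at which an element is nontrivial. -/
noncomputable def nontrivialSupp (x : ReducedPower 𝓘 M) : QuotAlg 𝓘 :=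
  QuotAlg.mk 𝓘 {i | Quotient.out x i ≠ 1}

theorem nontrivialSupp_mk (f : ι → M) :
    nontrivialSupp 𝓘 (ReducedPower.mk 𝓘 f) = QuotAlg.mk 𝓘 {i | f i ≠ 1} := by
  refine (quotAlg_mk_eq_mk_iff 𝓘).2 (almostAll_mono 𝓘 (p := fun i => Quotient.out
    (ReducedPower.mk 𝓘 f) i = f i) ?_ fun i h => by rw [h])
  exact (mk_eq_mk_iff 𝓘).1 (mk_out 𝓘 _)

theorem nontrivialSupp_surjective [Nontrivial M] (c : QuotAlg 𝓘) :
    ∃ x : ReducedPower 𝓘 M, nontrivialSupp 𝓘 x = c := by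
  classical
  obtain ⟨A, rfl⟩ := QuotAlg.mk_surjective 𝓘 c
  obtain ⟨g, hg⟩ := exists_ne (1 : M)
  refine ⟨ReducedPower.mk 𝓘 fun i => if i ∈ A then g else 1, ?_⟩
  rw [nontrivialSupp_mk]
  congr 1
  ext i
  by_cases hi : i ∈ A <;> simp [hi, hg]

theorem nontrivialSupp_mk_le {f g : ι → M} :
    nontrivialSupp 𝓘 (ReducedPower.mk 𝓘 f) ≤ nontrivialSupp 𝓘 (ReducedPower.mk 𝓘 g) ↔
      {i | ¬ (f i ≠ 1 → g i ≠ 1)} ∈ 𝓘 := by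
  rw [nontrivialSupp_mk, nontrivialSupp_mk, mk_le_mk_iff]

theorem nontrivialSupp_mk_le_supp {k : ℕ} {φ : groupLang.Formula (Fin k)} {f : Fin k → ι → M}
    {g : ι → M} :
    nontrivialSupp 𝓘 (ReducedPower.mk 𝓘 g) ≤ supp 𝓘 φ (fun j => ReducedPower.mk 𝓘 (f j)) ↔
      {i | ¬ (g i ≠ 1 → φ.Realize fun j => f j i)} ∈ 𝓘 := by
  rw [nontrivialSupp_mk, supp_mk, mk_le_mk_iff]

/-- The preimage of `K` under `σ` is again normal and nontrivial, hence contains `v`. -/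
theorem IsMonolithic.map (hv : IsMonolithic v) (σ : M ≃* M) {K : Subgroup M} (hK : K.Normal)
    (hne : K ≠ ⊥) : σ v ∈ K := by
  refine hv.mem (K.comap σ.toMonoidHom) (hK.comap _) fun h => ?_
  obtain ⟨x, hx, hx1⟩ := K.bot_or_exists_ne_one.resolve_left hne
  have : σ.symm x ∈ K.comap σ.toMonoidHom := by simpa using hx
  rw [h, Subgroup.mem_bot] at this
  exact hx1 (by simpa using this)

/-- The right side says that some tuple `z` satisfies `φ` at almost all coordinates and agrees with
`x` on the support of `y`. Agreement means that each quotient `t` of `z j` by `x j` has support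
disjoint from that of `y`: only the identity has its support inside both. This reduces supports of
`φ` to relations already definable in the group. -/
theorem IsMonolithic.le_supp_iff (hv : IsMonolithic v) {k : ℕ} {φ : groupLang.Formula (Fin k)}
    (hφ : IsHFormula φ) (hne : ∃ a : Fin k → M, φ.Realize a) (x : Fin k → ReducedPower 𝓘 M)
    (y : ReducedPower 𝓘 M) :
    nontrivialSupp 𝓘 y ≤ supp 𝓘 φ x ↔
      ∃ z, φ.Realize z ∧ ∀ j, ∃ t : ReducedPower 𝓘 M, t * x j = z j ∧
        ∀ w : ReducedPower 𝓘 M, nontrivialSupp 𝓘 w ≤ nontrivialSupp 𝓘 y →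
          nontrivialSupp 𝓘 w ≤ nontrivialSupp 𝓘 t → w * w = w := by
  classical
  obtain ⟨f, rfl⟩ := exists_mk_eq 𝓘 x
  obtain ⟨a, ha⟩ := hne
  rw [← mk_out 𝓘 y]
  generalize Quotient.out y = g
  rw [nontrivialSupp_mk_le_supp]
  constructor
  · intro h
    -- Off the support of `φ`, the tuple is replaced by the fixed realization `a`, so that `φ` holds
    -- everywhere.
    refine ⟨fun j => ReducedPower.mk 𝓘 fun i => if φ.Realize (fun j => f j i) then f j i else a j,
      (hφ.realize_formula_mk_iff 𝓘 _).2 (almostAll_of_forall 𝓘 fun i => ?_), fun j =>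
      ⟨ReducedPower.mk 𝓘 fun i => (if φ.Realize (fun j => f j i) then f j i else a j) * (f j i)⁻¹,
        ?_, fun w hwy hwt => ?_⟩⟩
    · by_cases hi : φ.Realize fun j => f j i
      · simp [hi]
      · simpa [hi] using ha
    · simp [mk_mul]
    · rw [← mk_out 𝓘 w] at hwy hwt ⊢
      rw [nontrivialSupp_mk_le] at hwy hwt
      rw [mk_mul, mk_eq_mk_iff]
      refine almostAll_mono₂ 𝓘 h (almostAll_mono₂ 𝓘 hwy hwt fun i => And.intro) ?_
      rintro i h ⟨hwy, hwt⟩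
      by_contra hw
      have hw1 : Quotient.out w i ≠ 1 := fun h => hw (by rw [h, mul_one])
      exact hwt hw1 (by rw [if_pos (h (hwy hw1)), mul_inv_cancel])
  · rintro ⟨z, hz, h⟩
    obtain ⟨z, rfl⟩ := exists_mk_eq 𝓘 z
    choose t ht ht' using h
    obtain ⟨t, rfl⟩ := exists_mk_eq 𝓘 t
    rw [hφ.realize_formula_mk_iff] at hz
    have h : ∀ j, {i | ¬ (g i ≠ 1 → f j i = z j i)} ∈ 𝓘 := by
      intro j
      have h₁ := ht j
      rw [mk_mul, mk_eq_mk_iff] at h₁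
      -- The test element has as support the intersection of the two supports; its triviality makes
      -- them disjoint.
      have h₂ := ht' j (ReducedPower.mk 𝓘 fun i => if g i ≠ 1 ∧ t j i ≠ 1 then v else 1)
        ((nontrivialSupp_mk_le 𝓘).2 (almostAll_of_forall 𝓘 fun i hi => ?_))
        ((nontrivialSupp_mk_le 𝓘).2 (almostAll_of_forall 𝓘 fun i hi => ?_))
      · rw [mk_mul, mk_eq_mk_iff] at h₂
        refine almostAll_mono₂ 𝓘 h₁ h₂ fun i h₁ h₂ hg => ?_
        by_cases hti : t j i = 1
        · rwa [hti, one_mul] at h₁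
        · rw [if_pos ⟨hg, hti⟩] at h₂
          exact absurd (mul_eq_left.1 h₂) hv.ne_one
      · by_contra hc
        exact hi (if_neg fun h => h.1 hc)
      · by_contra hc
        exact hi (if_neg fun h => h.2 hc)
    refine almostAll_mono₂ 𝓘 hz (almostAll_forall 𝓘 h) fun i hz h hg => ?_
    rwa [funext fun j => h j hg]

variable [Finite M]

theorem IsMonolithic.definable_le (hv : IsMonolithic v) {γ : Type} (a b : γ) :
    DefinablePred groupLang fun z : γ → ReducedPower 𝓘 M =>
      nontrivialSupp 𝓘 (z a) ≤ nontrivialSupp 𝓘 (z b) := by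
  classical
  obtain ⟨N, hN⟩ := exists_commProd_iff M
  obtain ⟨φ, hφ, hφ'⟩ := (HDefinable.commProd (M := M) (α := Fin 2) N
    (.free 0) (.free 1)).formula
  obtain ⟨ψ, hψ, hψ'⟩ := hv.exists_hFormula_orbit fun _ : Fin 1 => v
  have hφG : ∀ f g : ι → M, φ.Realize ![ReducedPower.mk 𝓘 f, ReducedPower.mk 𝓘 g] ↔
      {i | ¬ f i ∈ commClosure (g i)} ∈ 𝓘 := by
    intro f g
    have : ![ReducedPower.mk 𝓘 f, ReducedPower.mk 𝓘 g] =
        fun j => ReducedPower.mk 𝓘 (![f, g] j) := by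
      ext j
      fin_cases j <;> rfl
    rw [this, hφ.realize_formula_mk_iff]
    simp [hφ', hN]
  have hψG : ∀ f : ι → M, ψ.Realize ![ReducedPower.mk 𝓘 f] ↔
      {i | ¬ ∃ σ : M ≃* M, f i = σ v} ∈ 𝓘 := by
    intro f
    have : ![ReducedPower.mk 𝓘 f] = fun j => ReducedPower.mk 𝓘 (![f] j) := by
      ext j
      fin_cases j
      rfl
    rw [this, hψ.realize_formula_mk_iff]
    simp [hψ']
  -- For `v'` in the orbit of `v` at almost all coordinates, restricting `w` to the `commClosure` of
  -- `v'` makes only the triviality of `x` and `y` matter: the `commClosure` of a nontrivial element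
  -- contains that of `v'`, and the `commClosure` of `1` is trivial.
  have key : ∀ x y : ReducedPower 𝓘 M, nontrivialSupp 𝓘 x ≤ nontrivialSupp 𝓘 y ↔
      ∀ v', ψ.Realize ![v'] → ∀ w, φ.Realize ![w, v'] → φ.Realize ![w, x] →
        φ.Realize ![w, y] := by
    intro x y
    rw [← mk_out 𝓘 x, ← mk_out 𝓘 y]
    generalize Quotient.out x = f
    generalize Quotient.out y = g
    rw [nontrivialSupp_mk_le]
    constructor
    · intro h v' hv' w hw hwf
      rw [← mk_out 𝓘 v'] at hv' hw
      rw [← mk_out 𝓘 w] at hw hwf ⊢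
      rw [hφG] at hw hwf ⊢
      rw [hψG] at hv'
      refine almostAll_mono₂ 𝓘 (almostAll_mono₂ 𝓘 hw hv' fun i => And.intro)
        (almostAll_mono₂ 𝓘 hwf h fun i => And.intro) ?_
      rintro i ⟨hw, σ, hσ⟩ ⟨hwf, h⟩
      by_cases hf : f i = 1
      · rw [hf, commClosure_one, Subgroup.mem_bot] at hwf
        rw [hwf]
        exact Subgroup.one_mem _
      · refine SymReducedPower.commClosure_le _ (commClosure_normal _) ?_ hw
        rw [hσ]
        exact hv.map σ (commClosure_normal _) (hv.commClosure_ne_bot (h hf))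
    · intro h
      -- With `v'` constantly `v`, the element `w` equal to `v` exactly on the support of `f` must
      -- lie in the `commClosure` of `g`, so `g` is nontrivial there.
      have h := h (ReducedPower.mk 𝓘 fun _ => v)
        ((hψG _).2 (almostAll_of_forall 𝓘 fun i => ⟨MulEquiv.refl M, rfl⟩))
        (ReducedPower.mk 𝓘 fun i => if f i = 1 then 1 else v)
        ((hφG _ _).2 (almostAll_of_forall 𝓘 fun i => ?_))
        ((hφG _ _).2 (almostAll_of_forall 𝓘 fun i => ?_))
      · refine almostAll_mono 𝓘 ((hφG _ _).1 h) fun i hi hf hg => ?_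
        rw [if_neg hf, hg, commClosure_one, Subgroup.mem_bot] at hi
        exact hv.ne_one hi
      · split_ifs
        · exact Subgroup.one_mem _
        · exact hv.mem_commClosure hv.ne_one
      · split_ifs with hf
        · exact Subgroup.one_mem _
        · exact hv.mem_commClosure hf
  have hφd : ∀ {δ : Type} (c d : δ), DefinablePred groupLang
      fun z : δ → ReducedPower 𝓘 M => φ.Realize ![z c, z d] := by
    intro δ c d
    convert (DefinablePred.realize φ).comp ![c, d] using 3
    ext j
    fin_cases j <;> rfl
  have hψd : ∀ {δ : Type} (c : δ), DefinablePred groupLang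
      fun z : δ → ReducedPower 𝓘 M => ψ.Realize ![z c] := by
    intro δ c
    convert (DefinablePred.realize ψ).comp ![c] using 3
    ext j
    fin_cases j
    rfl
  simp only [key]
  exact .all (.imp (hψd _) (.all (.imp (hφd (Sum.inr ()) (Sum.inl (Sum.inr ())))
    (.imp (hφd (Sum.inr ()) (Sum.inl (Sum.inl a))) (hφd (Sum.inr ()) (Sum.inl (Sum.inl b)))))))

theorem IsMonolithic.isInterpretableExpansion (hv : IsMonolithic v) {J : Type} (arity : J → ℕ)
    (Φ : ∀ j, groupLang.Formula (Fin (arity j))) (hΦ : ∀ j, IsHFormula (Φ j))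
    (hne : ∀ j, ∃ a : Fin (arity j) → M, (Φ j).Realize a) :
    IsInterpretableExpansion groupLang (ReducedPower 𝓘 M) (QuotAlg 𝓘) arity
      fun j => supp 𝓘 (M := M) (Φ j) := by
  have : Nontrivial M := ⟨v, 1, hv.ne_one⟩
  refine ⟨1, Set.univ, fun y => nontrivialSupp 𝓘 (y 0), Set.definable_univ, fun c => ?_, ?_, ?_, ?_⟩
  · obtain ⟨x, hx⟩ := nontrivialSupp_surjective (M := M) 𝓘 c
    exact ⟨fun _ => x, trivial, hx⟩
  · refine ((hv.definable_le 𝓘 (Sum.inl (0 : Fin 1)) (Sum.inr (0 : Fin 1))).and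
      (hv.definable_le 𝓘 (Sum.inr (0 : Fin 1)) (Sum.inl (0 : Fin 1)))).congr fun z => ?_
    simp only [Set.mem_univ, true_and, Function.comp_apply]
    exact ⟨fun h => quotAlg_le_antisymm 𝓘 h.1 h.2,
      fun h => h ▸ ⟨quotAlg_le_refl 𝓘 _, quotAlg_le_refl 𝓘 _⟩⟩
  · refine (hv.definable_le 𝓘 (Sum.inl (0 : Fin 1)) (Sum.inr (0 : Fin 1))).congr fun z => ?_
    simp
  · intro j
    have hle : ∀ {γ : Type} (x : Fin (arity j) → γ) (y : γ),
        DefinablePred groupLang fun z : γ → ReducedPower 𝓘 M =>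
          nontrivialSupp 𝓘 (z y) ≤ supp 𝓘 (Φ j) fun i => z (x i) := by
      intro γ x y
      simp only [hv.le_supp_iff 𝓘 (hΦ j) (hne j)]
      exact .exs (.and ((DefinablePred.realize (Φ j)).comp Sum.inr) (.forall_finite fun i =>
        .ex (.and (.mul_eq (Sum.inr ()) (Sum.inl (Sum.inl (x i))) (Sum.inl (Sum.inr i)))
          (.all (.imp (hv.definable_le 𝓘 (Sum.inr ()) (Sum.inl (Sum.inl (Sum.inl y))))
            (.imp (hv.definable_le 𝓘 (Sum.inr ()) (Sum.inl (Sum.inr ())))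
              (.mul_eq (Sum.inr ()) (Sum.inr ()) (Sum.inr ()))))))))
    -- Only the comparison of codes with supports from below is definable so far; since every class
    -- has a code, equality says that `z (Sum.inr 0)` codes the largest class below the support.
    have h : DefinablePred groupLang fun z : Fin (arity j) ⊕ Fin 1 → ReducedPower 𝓘 M =>
        (nontrivialSupp 𝓘 (z (Sum.inr 0)) ≤ supp 𝓘 (Φ j) fun i => z (Sum.inl i)) ∧
        ∀ w, (nontrivialSupp 𝓘 w ≤ supp 𝓘 (Φ j) fun i => z (Sum.inl i)) →
          nontrivialSupp 𝓘 w ≤ nontrivialSupp 𝓘 (z (Sum.inr 0)) :=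
      (hle Sum.inl (Sum.inr 0)).and (.all (.imp
        (hle (fun i => Sum.inl (Sum.inl i)) (Sum.inr ()))
        (hv.definable_le 𝓘 (Sum.inr ()) (Sum.inl (Sum.inr 0)))))
    refine h.congr fun z => ?_
    simp only [Set.mem_univ, true_and]
    change _ ↔ (supp 𝓘 (Φ j) fun i => z (Sum.inl i)) = nontrivialSupp 𝓘 (z (Sum.inr 0))
    constructor
    · rintro ⟨h₁, h₂⟩
      obtain ⟨w, hw⟩ := nontrivialSupp_surjective (M := M) 𝓘
        (supp 𝓘 (Φ j) fun i => z (Sum.inl i))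
      exact quotAlg_le_antisymm 𝓘 (hw ▸ h₂ w (hw ▸ quotAlg_le_refl 𝓘 _)) h₁
    · intro h
      rw [h]
      exact ⟨quotAlg_le_refl 𝓘 _, fun w hw => hw⟩

end Interpretation

/-! ### Substituting terms in formulas of the quotient algebra -/

section Substitution

universe u v w

instance quotAlgStructure {ι : Type u} (𝓘 : Order.Ideal (Set ι)) :
    Language.order.Structure (QuotAlg 𝓘) :=
  orderStructure (QuotAlg 𝓘)

theorem DefinablePred.le {ι : Type u} {𝓘 : Order.Ideal (Set ι)} {γ : Type v} (c d : γ) :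
    DefinablePred Language.order fun z : γ → QuotAlg 𝓘 => z c ≤ z d := by
  refine (DefinablePred.realize ((leSymb : Language.order.Relations 2).formula₂
    (Term.var c) (Term.var d))).congr fun z => ?_
  rw [Formula.realize_rel₂]
  rfl

variable {ι : Type u} {𝓘 : Order.Ideal (Set ι)} {J : Type w} {arity : J → ℕ} {G : Type v} [Mul G]
  (f : ∀ j, (Fin (arity j) → G) → QuotAlg 𝓘) {a b : ℕ}

/-- The language of orders has no function symbols, so a term is a variable: either one replaced by
`τ` or a bound one. -/
theorem exists_bTerm {γ : Type} {m : ℕ} (τ : γ → BTerm arity a b)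
    (t : Language.order.Term (γ ⊕ Fin m)) :
    ∃ s : BTerm arity a (b + m), ∀ x y xs, s.realize f x (Fin.append y xs) =
      t.realize (Sum.elim (fun c => (τ c).realize f x y) xs) := by
  cases t with
  | var c =>
    rcases c with c | i
    · rcases h : τ c with i | ⟨j, ts⟩
      · exact ⟨.var (Fin.castAdd m i), fun x y xs => by simp [BTerm.realize, h]⟩
      · exact ⟨.app j ts, fun x y xs => by simp [BTerm.realize, h]⟩
    · exact ⟨.var (Fin.natAdd b i), fun x y xs => by simp [BTerm.realize]⟩
  | func F => exact nomatch F

theorem exists_isBoolean {γ : Type} (τ : γ → BTerm arity a b) {m : ℕ}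
    (φ : Language.order.BoundedFormula γ m) :
    ∃ ψ : TSFormula arity a (b + m), IsBoolean ψ ∧ ∀ x y xs, ψ.Realize f x (Fin.append y xs) ↔
      φ.Realize (fun c => (τ c).realize f x y) xs := by
  induction φ with
  | falsum => exact ⟨.falsum, .falsum, fun _ _ _ => Iff.rfl⟩
  | equal s t =>
    obtain ⟨s', hs⟩ := exists_bTerm f τ s
    obtain ⟨t', ht⟩ := exists_bTerm f τ t
    refine ⟨.eqB s' t', .eqB _ _, fun x y xs => ?_⟩
    simp only [TSFormula.Realize, BoundedFormula.Realize, hs, ht]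
  | rel R ts =>
    cases R
    obtain ⟨s', hs⟩ := exists_bTerm f τ (ts 0)
    obtain ⟨t', ht⟩ := exists_bTerm f τ (ts 1)
    refine ⟨.subB s' t', .subB _ _, fun x y xs => ?_⟩
    simp only [TSFormula.Realize, BoundedFormula.Realize, hs, ht]
    rfl
  | imp _ _ ih₁ ih₂ =>
    obtain ⟨ψ₁, h₁, h₁'⟩ := ih₁
    obtain ⟨ψ₂, h₂, h₂'⟩ := ih₂
    refine ⟨.imp ψ₁ ψ₂, .imp h₁ h₂, fun x y xs => ?_⟩
    simp only [TSFormula.Realize, BoundedFormula.Realize, h₁', h₂']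
  | all _ ih =>
    obtain ⟨ψ, h, h'⟩ := ih
    refine ⟨.allB ψ, .allB h, fun x y xs => ?_⟩
    simp only [TSFormula.Realize, BoundedFormula.Realize, ← h', Fin.append_snoc]

theorem DefinablePred.exists_isBoolean {γ : Type} (τ : γ → BTerm arity a b)
    {P : (γ → QuotAlg 𝓘) → Prop} (hP : DefinablePred Language.order P) :
    ∃ ψ : TSFormula arity a b, IsBoolean ψ ∧ ∀ x y, ψ.Realize f x y ↔
      P fun c => (τ c).realize f x y := by
  obtain ⟨φ, hφ⟩ := Set.empty_definable_iff.1 hP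
  obtain ⟨ψ, hψ, hψ'⟩ := SymReducedPower.exists_isBoolean f τ φ
  refine ⟨ψ, hψ, fun x y => ?_⟩
  have h := hψ' x y default
  have hy : Fin.append y (default : Fin 0 → QuotAlg 𝓘) = y := by
    ext i
    exact Fin.append_left y _ i
  rw [hy] at h
  refine h.trans ?_
  exact (Set.ext_iff.1 hφ fun c => (τ c).realize f x y).symm

end Substitution

/-! ### Supports of types -/

section TypeSupp

universe u w

variable {ι : Type u} (𝓘 : Order.Ideal (Set ι)) {M : Type} [Group M] {v : M} {k : ℕ}

/-- Complete types of tuples over the theory of `M`. -/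
abbrev TupleTypes (M : Type) [Group M] (k : ℕ) : Type :=
  (groupLang.completeTheory M).CompleteType (Fin k)

/-- The class of the set of coordinates at which a tuple has a given type. -/
noncomputable def typeSupp (x : Fin k → ReducedPower 𝓘 M) (p : TupleTypes M k) : QuotAlg 𝓘 :=
  QuotAlg.mk 𝓘 {i | tupleType (fun j => Quotient.out (x j) i) = p}

theorem typeSupp_mk (f : Fin k → ι → M) (p : TupleTypes M k) :
    typeSupp 𝓘 (fun j => ReducedPower.mk 𝓘 (f j)) p =
      QuotAlg.mk 𝓘 {i | tupleType (fun j => f j i) = p} := by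
  refine (quotAlg_mk_eq_mk_iff 𝓘).2 (almostAll_mono 𝓘 (almostAll_forall 𝓘
    fun j => (mk_eq_mk_iff 𝓘).1 (mk_out 𝓘 (ReducedPower.mk 𝓘 (f j)))) fun i h => ?_)
  rw [funext h]

theorem supp_eq_typeSupp {φ : groupLang.Formula (Fin k)} {p : TupleTypes M k} (hφ : Isolates φ p)
    (x : Fin k → ReducedPower 𝓘 M) : supp 𝓘 φ x = typeSupp 𝓘 x p := by
  unfold supp typeSupp
  simp only [hφ.realize_iff]

variable [Finite M]

/-- The support of `χ` is the union of the supports of the finitely many types containing `χ`.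
Quantifying over upper bounds avoids joins, for which the language of the algebra has no symbol. -/
theorem forall_typeSupp_le_iff (χ : groupLang.Formula (Fin k)) (f : Fin k → ι → M)
    (q : ι → Prop) :
    (∀ p : {p : TupleTypes M k // Formula.equivSentence χ ∈ p},
        typeSupp 𝓘 (fun j => ReducedPower.mk 𝓘 (f j)) p.1 ≤ QuotAlg.mk 𝓘 {i | q i}) ↔
      {i | ¬ ((χ.Realize fun j => f j i) → q i)} ∈ 𝓘 := by
  simp only [typeSupp_mk, mk_le_mk_iff]
  constructor
  · intro h
    refine almostAll_mono 𝓘 (almostAll_forall 𝓘 h) fun i hi hχ => ?_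
    exact hi ⟨_, equivSentence_mem_iff_realize.2 hχ⟩ rfl
  · rintro h ⟨p, hp⟩
    refine almostAll_mono 𝓘 h fun i hi hip => hi ?_
    rwa [← equivSentence_mem_iff_realize, show (groupLang.completeTheory M).typeOf _ = p from hip]

/-- The families of supports of types of one-element extensions of a tuple with given supports of
types. -/
def IsRefinement (r : TupleTypes M (k + 1) → TupleTypes M k) (A : TupleTypes M k → QuotAlg 𝓘)
    (C : TupleTypes M (k + 1) → QuotAlg 𝓘) : Prop :=
  (∀ q, C q ≤ A (r q)) ∧
  (∀ qs : {qs : TupleTypes M (k + 1) × TupleTypes M (k + 1) // qs.1 ≠ qs.2},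
    ∀ e, e ≤ C qs.1.1 → e ≤ C qs.1.2 → ∀ e', e ≤ e') ∧
  ∀ d, (∀ q, C q ≤ d) → ∀ e, e ≤ d

/-- This turns a quantifier over the group into one over finite families of classes: a partition
indexed by `(k + 1)`-types, each class lying below the support of the restricted type, is the type
partition of an extension of `x`. -/
theorem isRefinement_iff {r : TupleTypes M (k + 1) → TupleTypes M k}
    (hr : ∀ (a : Fin k → M) q, tupleType a = r q ↔
      ∃ g, tupleType (Fin.snoc a g : Fin (k + 1) → M) = q)
    (x : Fin k → ReducedPower 𝓘 M) (C : TupleTypes M (k + 1) → QuotAlg 𝓘) :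
    IsRefinement 𝓘 r (typeSupp 𝓘 x) C ↔
      ∃ g : ReducedPower 𝓘 M, typeSupp 𝓘 (Fin.snoc x g : Fin (k + 1) → ReducedPower 𝓘 M) = C := by
  obtain ⟨f, rfl⟩ := exists_mk_eq 𝓘 x
  constructor
  · rintro ⟨h₁, h₂, h₃⟩
    choose D hD using fun q => QuotAlg.mk_surjective 𝓘 (C q)
    obtain rfl : (fun q => QuotAlg.mk 𝓘 (D q)) = C := funext hD
    simp only [typeSupp_mk] at h₁
    have h₂' : ∀ qs : {qs : TupleTypes M (k + 1) × TupleTypes M (k + 1) // qs.1 ≠ qs.2},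
        {i | ¬ ¬ (i ∈ D qs.1.1 ∧ i ∈ D qs.1.2)} ∈ 𝓘 := fun qs =>
      (mk_le_mk_iff 𝓘 (q := fun _ => False)).1 (h₂ qs _
        ((mk_le_mk_iff 𝓘).2 (almostAll_of_forall 𝓘 fun i h => h.1))
        ((mk_le_mk_iff 𝓘).2 (almostAll_of_forall 𝓘 fun i h => h.2)) _)
    have h₃' : {i | ¬ (True → ∃ q, i ∈ D q)} ∈ 𝓘 :=
      (mk_le_mk_iff 𝓘).1 (h₃ (QuotAlg.mk 𝓘 {i | ∃ q, i ∈ D q})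
        (fun q => (mk_le_mk_iff 𝓘).2 (almostAll_of_forall 𝓘 fun i h => ⟨q, h⟩)) _)
    have h₁' := almostAll_forall 𝓘 fun q => (mk_le_mk_iff 𝓘).1 (h₁ q)
    -- At almost every `i` exactly one `D q` contains `i`, and the tuple at `i` has type `r q`, so
    -- some `g` extends it to a tuple of type `q`.
    let g : ι → M := fun i => Classical.epsilon fun g =>
      ∃ q, i ∈ D q ∧ tupleType (Fin.snoc (fun j => f j i) g : Fin (k + 1) → M) = q
    refine ⟨ReducedPower.mk 𝓘 g, funext fun q => ?_⟩
    rw [snoc_mk, typeSupp_mk]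
    refine (quotAlg_mk_eq_mk_iff 𝓘).2 (almostAll_mono₂ 𝓘 h₁'
      (almostAll_mono₂ 𝓘 (almostAll_forall 𝓘 h₂') h₃' fun i => And.intro) ?_)
    rintro i h₁ ⟨h₂, h₃⟩
    obtain ⟨q', hq'⟩ := h₃ trivial
    obtain ⟨g', hg'⟩ := (hr _ q').1 (h₁ q' hq')
    obtain ⟨q'', hq'', hg⟩ := Classical.epsilon_spec (p := fun g =>
      ∃ q, i ∈ D q ∧ tupleType (Fin.snoc (fun j => f j i) g : Fin (k + 1) → M) = q)
      ⟨g', q', hq', hg'⟩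
    rw [snoc_apply_coord]
    change tupleType (Fin.snoc (fun j => f j i) (g i)) = q'' at hg
    rw [hg]
    constructor
    · rintro rfl
      exact hq''
    · intro hq
      by_contra hne
      exact h₂ ⟨(q'', q), hne⟩ ⟨hq'', hq⟩
  · rintro ⟨g, rfl⟩
    rw [← mk_out 𝓘 g]
    generalize Quotient.out g = g
    rw [snoc_mk]
    unfold IsRefinement
    simp only [typeSupp_mk, snoc_apply_coord, mk_le_mk_iff]
    refine ⟨fun q => almostAll_of_forall 𝓘 fun i hi => (hr _ q).2 ⟨_, hi⟩, ?_, ?_⟩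
    · rintro ⟨⟨q, q'⟩, hne⟩ e he he' e'
      obtain ⟨E, rfl⟩ := QuotAlg.mk_surjective 𝓘 e
      obtain ⟨E', rfl⟩ := QuotAlg.mk_surjective 𝓘 e'
      exact (mk_le_mk_iff 𝓘 (p := (· ∈ E)) (q := (· ∈ E'))).2 (almostAll_mono₂ 𝓘
        ((mk_le_mk_iff 𝓘 (p := (· ∈ E))).1 he) ((mk_le_mk_iff 𝓘 (p := (· ∈ E))).1 he')
        fun i h h' hi => absurd ((h hi).symm.trans (h' hi)) hne)
    · intro d hd e
      obtain ⟨D, rfl⟩ := QuotAlg.mk_surjective 𝓘 d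
      obtain ⟨E, rfl⟩ := QuotAlg.mk_surjective 𝓘 e
      exact (mk_le_mk_iff 𝓘 (p := (· ∈ E)) (q := (· ∈ D))).2 (almostAll_mono 𝓘
        (almostAll_forall 𝓘 fun q => (mk_le_mk_iff 𝓘 (q := (· ∈ D))).1 (hd q))
        fun i h _ => h _ rfl)

end TypeSupp

/-! ### Relative quantifier elimination -/

section Elimination

universe u w

variable {ι : Type u} (𝓘 : Order.Ideal (Set ι)) {M : Type} [Group M] [Finite M] {v : M}
  {J : Type w} {arity : J → ℕ} (Φ : ∀ j, groupLang.Formula (Fin (arity j))) {a b : ℕ}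

/-- The value of a term is described by its upper bounds, and a support applied to group terms is
the union of the supports of the types containing the substituted formula. -/
theorem BTerm.exists_definable_le (τ : BTerm arity a b) :
    ∃ P : (TupleTypes M a ⊕ Fin b → QuotAlg 𝓘) → QuotAlg 𝓘 → Prop,
      (∀ {γ : Type} (c : TupleTypes M a ⊕ Fin b → γ) (d : γ), DefinablePred Language.order
        fun z : γ → QuotAlg 𝓘 => P (fun i => z (c i)) (z d)) ∧
      ∀ (x : Fin a → ReducedPower 𝓘 M) y e,
        τ.realize (fun j => supp 𝓘 (Φ j)) x y ≤ e ↔ P (Sum.elim (typeSupp 𝓘 x) y) e := by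
  cases τ with
  | var i => exact ⟨fun z e => z (Sum.inr i) ≤ e, fun c d => .le _ _, fun x y e => Iff.rfl⟩
  | app j t =>
    let χ : groupLang.Formula (Fin a) := (Φ j).subst t
    refine ⟨fun z e => ∀ p : {p : TupleTypes M a // Formula.equivSentence χ ∈ p},
      z (Sum.inl p.1) ≤ e, fun c d => .forall_finite fun p => .le _ _, fun x y e => ?_⟩
    obtain ⟨f, rfl⟩ := exists_mk_eq 𝓘 x
    obtain ⟨E, rfl⟩ := QuotAlg.mk_surjective 𝓘 e
    simp only [BTerm.realize, Sum.elim_inl, term_realize_mk, supp_mk]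
    refine (mk_le_mk_iff 𝓘 (q := (· ∈ E))).trans
      (Iff.trans ?_ (forall_typeSupp_le_iff 𝓘 χ f (· ∈ E)).symm)
    simp only [χ, Formula.Realize, BoundedFormula.realize_subst]

/-- Satisfaction of a two-sorted formula is a definable property, in the quotient algebra, of the
supports of the types of the elements of the group sort. -/
theorem IsMonolithic.exists_definablePred (hv : IsMonolithic v) (φ : TSFormula arity a b) :
    ∃ P : (TupleTypes M a ⊕ Fin b → QuotAlg 𝓘) → Prop, DefinablePred Language.order P ∧
      ∀ (x : Fin a → ReducedPower 𝓘 M) y,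
        φ.Realize (fun j => supp 𝓘 (Φ j)) x y ↔ P (Sum.elim (typeSupp 𝓘 x) y) := by
  induction φ with
  | falsum => exact ⟨fun _ => False, .false, fun _ _ => Iff.rfl⟩
  | @eqG a b s t =>
    -- The equation holds in the reduced power when the support of its negation lies below every
    -- class.
    let χ : groupLang.Formula (Fin a) := (s.equal t).not
    refine ⟨fun z => ∀ e, ∀ p : {p : TupleTypes M a // Formula.equivSentence χ ∈ p},
      z (Sum.inl p.1) ≤ e, .all (.forall_finite fun p => .le (Sum.inl (Sum.inl _)) (Sum.inr ())),
      fun x y => ?_⟩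
    obtain ⟨f, rfl⟩ := exists_mk_eq 𝓘 x
    simp only [TSFormula.Realize, Sum.elim_inl, term_realize_mk, mk_eq_mk_iff]
    constructor
    · intro h e
      obtain ⟨E, rfl⟩ := QuotAlg.mk_surjective 𝓘 e
      refine (forall_typeSupp_le_iff 𝓘 χ f (· ∈ E)).2 (almostAll_mono 𝓘 h fun i hi hχ => ?_)
      simp only [χ, Formula.realize_not, Formula.realize_equal] at hχ
      exact absurd hi hχ
    · intro h
      refine almostAll_mono 𝓘 ((forall_typeSupp_le_iff 𝓘 χ f fun _ => False).1 (h _)) fun i hi => ?_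
      simpa [χ, Formula.realize_not, Formula.realize_equal] using hi
  | eqB s t =>
    obtain ⟨P, hP, hP'⟩ := s.exists_definable_le 𝓘 (M := M) Φ
    obtain ⟨Q, hQ, hQ'⟩ := t.exists_definable_le 𝓘 (M := M) Φ
    refine ⟨fun z => ∀ e, P z e ↔ Q z e, .all (.iff (hP _ _) (hQ _ _)), fun x y => ?_⟩
    simp only [TSFormula.Realize, ← hP', ← hQ']
    exact ⟨fun h e => h ▸ Iff.rfl, fun h => quotAlg_le_antisymm 𝓘
      ((h _).2 (quotAlg_le_refl 𝓘 _)) ((h _).1 (quotAlg_le_refl 𝓘 _))⟩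
  | subB s t =>
    obtain ⟨P, hP, hP'⟩ := s.exists_definable_le 𝓘 (M := M) Φ
    obtain ⟨Q, hQ, hQ'⟩ := t.exists_definable_le 𝓘 (M := M) Φ
    refine ⟨fun z => ∀ e, Q z e → P z e, .all (.imp (hQ _ _) (hP _ _)), fun x y => ?_⟩
    simp only [TSFormula.Realize, ← hP', ← hQ']
    exact ⟨fun h e => quotAlg_le_trans 𝓘 h, fun h => h _ (quotAlg_le_refl 𝓘 _)⟩
  | imp _ _ ih₁ ih₂ =>
    obtain ⟨P, hP, hP'⟩ := ih₁
    obtain ⟨Q, hQ, hQ'⟩ := ih₂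
    refine ⟨_, hP.imp hQ, fun x y => ?_⟩
    simp only [TSFormula.Realize, hP', hQ']
  | @allG a b _ ih =>
    obtain ⟨P, hP, hP'⟩ := ih
    obtain ⟨r, hr⟩ := hv.exists_restriction a
    -- There are finitely many types of `(a + 1)`-tuples, so `C` is a finite tuple of variables of
    -- the algebra.
    refine ⟨fun z => ∀ C, IsRefinement 𝓘 r (fun p => z (Sum.inl p)) C →
      P (Sum.elim C fun i => z (Sum.inr i)), .alls (.imp ?_ ?_), fun x y => ?_⟩
    · exact .and (.forall_finite fun q => .le (Sum.inr q) (Sum.inl (Sum.inl (r q))))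
        (.and (.forall_finite fun qs => .all (.imp (.le (Sum.inr ()) (Sum.inl (Sum.inr qs.1.1)))
          (.imp (.le (Sum.inr ()) (Sum.inl (Sum.inr qs.1.2)))
            (.all (.le (Sum.inl (Sum.inr ())) (Sum.inr ()))))))
        (.all (.imp (.forall_finite fun q => .le (Sum.inl (Sum.inr q)) (Sum.inr ()))
          (.all (.le (Sum.inr ()) (Sum.inl (Sum.inr ())))))))
    · refine (hP.comp (Sum.elim Sum.inr fun i => Sum.inl (Sum.inr i))).congr fun z => ?_
      refine iff_of_eq (congrArg P (funext fun i => ?_))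
      cases i <;> rfl
    · simp only [TSFormula.Realize, hP', Sum.elim_inl, Sum.elim_inr, isRefinement_iff 𝓘 hr]
      exact ⟨fun h C ⟨g, hg⟩ => hg ▸ h g, fun h g => h _ ⟨g, rfl⟩⟩
  | @allB a b _ ih =>
    obtain ⟨P, hP, hP'⟩ := ih
    refine ⟨fun z => ∀ e, P (Sum.elim (fun p => z (Sum.inl p))
      (Fin.snoc (fun i => z (Sum.inr i)) e : Fin (b + 1) → QuotAlg 𝓘)), .all ?_, fun x y => ?_⟩
    · refine (hP.comp (Sum.elim (fun p => Sum.inl (Sum.inl p))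
        (Fin.snoc (fun i => Sum.inl (Sum.inr i)) (Sum.inr ()) :
          Fin (b + 1) → (TupleTypes M a ⊕ Fin b) ⊕ Unit))).congr fun z => ?_
      refine iff_of_eq (congrArg P (funext fun i => ?_))
      rcases i with p | i
      · rfl
      · refine Fin.lastCases ?_ (fun i => ?_) i <;> simp
    · simp only [TSFormula.Realize, hP', Sum.elim_inl, Sum.elim_inr]

theorem typeSupp_eq_top (x : Fin 0 → ReducedPower 𝓘 M) (p : TupleTypes M 0) (e : QuotAlg 𝓘) :
    e ≤ typeSupp 𝓘 x p := by
  obtain ⟨E, rfl⟩ := QuotAlg.mk_surjective 𝓘 e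
  refine (mk_le_mk_iff 𝓘 (p := (· ∈ E))).2 (almostAll_of_forall 𝓘 fun i _ => ?_)
  obtain ⟨c, rfl⟩ := exists_typeOf_eq p
  exact congrArg tupleType (Subsingleton.elim _ _)

end Elimination

theorem eliminatesQuantifiersRelative {n : ℕ} {v : Equiv.Perm (Fin n)} (hv : IsMonolithic v)
    {Φ : ∀ s : SuppSymbol n, groupLang.Formula (Fin s.arity)} (hΦ : IsIsolatingFamily Φ)
    {ι : Type*} (𝓘 : Order.Ideal (Set ι)) :
    EliminatesQuantifiersRelative (arity := SuppSymbol.arity)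
      fun s => supp 𝓘 (M := Equiv.Perm (Fin n)) (Φ s) := by
  intro a b φ
  obtain ⟨P, hP, hP'⟩ := hv.exists_definablePred 𝓘 Φ φ
  cases a with
  | zero =>
    -- Without group variables no support term is available, as all arities are positive. The
    -- supports of 0-types all equal the top element, which is definable from the order and so can
    -- be quantified away.
    have hQ : DefinablePred Language.order fun y : Fin b → QuotAlg 𝓘 =>
        ∃ C : TupleTypes (Equiv.Perm (Fin n)) 0 → QuotAlg 𝓘, (∀ p, ∀ e, e ≤ C p) ∧
          P (Sum.elim C y) := by
      refine .exs (.and (.forall_finite fun p => .all (.le (Sum.inr ()) (Sum.inl (Sum.inr p)))) ?_)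
      refine (hP.comp (Sum.elim Sum.inr Sum.inl)).congr fun z => ?_
      refine iff_of_eq (congrArg P (funext fun i => ?_))
      cases i <;> rfl
    obtain ⟨ψ, hψ, hψ'⟩ := hQ.exists_isBoolean
      (fun s => supp 𝓘 (M := Equiv.Perm (Fin n)) (Φ s)) (a := 0) BTerm.var
    refine ⟨ψ, .boolean hψ, fun x y => ?_⟩
    rw [hψ', hP']
    simp only [BTerm.realize]
    constructor
    · exact fun h => ⟨_, typeSupp_eq_top 𝓘 x, h⟩
    · rintro ⟨C, hC, h⟩
      rwa [show typeSupp 𝓘 x = C from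
        funext fun p => quotAlg_le_antisymm 𝓘 (hC p _) (typeSupp_eq_top 𝓘 x p _)]
  | succ k =>
    obtain ⟨ψ, hψ, hψ'⟩ := hP.exists_isBoolean
      (fun s => supp 𝓘 (M := Equiv.Perm (Fin n)) (Φ s)) (a := k + 1) (b := b)
      (Sum.elim (fun p => BTerm.app (J := SuppSymbol n) (arity := SuppSymbol.arity) ⟨k, p⟩
        fun i => Term.var i) BTerm.var)
    refine ⟨ψ, .boolean hψ, fun x y => ?_⟩
    rw [hψ', hP']
    refine iff_of_eq (congrArg P (funext fun c => ?_))
    rcases c with p | i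
    · exact (supp_eq_typeSupp 𝓘 (hΦ ⟨k, p⟩).2 x).symm
    · rfl

end SymReducedPower

theorem corollary4p25 (n : ℕ) (hn : 4 ≤ n) (hn6 : n ≠ 6) :
    (∃ Φ : ∀ s : SymReducedPower.SuppSymbol n, SymReducedPower.groupLang.Formula (Fin s.arity),
      SymReducedPower.IsIsolatingFamily Φ) ∧
    ∀ Φ : ∀ s : SymReducedPower.SuppSymbol n, SymReducedPower.groupLang.Formula (Fin s.arity),
      SymReducedPower.IsIsolatingFamily Φ →
      ∀ {ι : Type*} (𝓘 : Order.Ideal (Set ι)), Set.univ ∉ 𝓘 →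
        SymReducedPower.IsInterpretableExpansion SymReducedPower.groupLang
          (SymReducedPower.ReducedPower 𝓘 (Equiv.Perm (Fin n))) (SymReducedPower.QuotAlg 𝓘)
          SymReducedPower.SuppSymbol.arity
          (fun s => SymReducedPower.supp 𝓘 (M := Equiv.Perm (Fin n)) (Φ s)) ∧
        SymReducedPower.EliminatesQuantifiersRelative
          (arity := SymReducedPower.SuppSymbol.arity)
          (fun s => SymReducedPower.supp 𝓘 (M := Equiv.Perm (Fin n)) (Φ s)) := by
  obtain ⟨v, hv⟩ := SymReducedPower.exists_isMonolithic_perm hn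
  refine ⟨?_, fun Φ hΦ ι 𝓘 _ => ⟨?_, SymReducedPower.eliminatesQuantifiersRelative hv hΦ 𝓘⟩⟩
  · choose Φ hΦ using fun s : SymReducedPower.SuppSymbol n => hv.exists_isolating s.2
    exact ⟨Φ, hΦ⟩
  · refine hv.isInterpretableExpansion 𝓘 _ Φ (fun s => (hΦ s).1) fun s => ?_
    obtain ⟨a, ha⟩ := SymReducedPower.exists_typeOf_eq s.2
    exact ⟨a, ((hΦ s).2.realize_iff a).2 ha⟩
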